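/- **Setting.** Let $\mathcal S$ be a finite state space with transition matrix $\mathcal P(s'|s)$, transition rewards $\mathcal R(s,s')$, discount factor $0<\gamma<1$, and feature vectors $\phi(s)\in\mathbb R^d$ forming the rows of the feature matrix $\Phi$. Write $\|\cdot\|$ for the Euclidean norm. Assume: (1) $|\mathcal R(s,s')|\le B$ for all $s,s'$; (2) for all $s,s'$ the limit $\pi(s')=\lim_{t\to\infty}\mathbb P(s_t=s'\mid s_0=s)$ exists, does not depend on $s$ and is positive, and there are $\bar\kappa>0$, $0<\rho<1$ with $\sup_s\sum_{s'}|\mathbb P(s_t=s'\mid s_0=s)-\pi(s')|\le\bar\kappa\rho^t$ for all $t\ge 0$; (3) $\|\phi(s)\|\le 1$ for all $s$ and $\Phi$ has full column rank. Let $\omega>0$ be the least eigenvalue of $\Phi^\top\mathrm{Diag}(\pi)\Phi$, let $(\mathcal T V)(s)=\sum_{s'}\mathcal P(s'|s)\bigl(\mathcal R(s,s')+\gamma V(s')\bigr)$, and let $\theta^*$ be the solution of the projected Bellman equation $\Phi\theta^*=\mathrm{Proj}_\Phi(\mathcal T\Phi\theta^*)$, where $\mathrm{Proj}_\Phi$ is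 the projection onto the column span of $\Phi$ in the norm $\|V\|_\pi=(\sum_s\pi(s)V(s)^2)^{1/2}$. **Algorithm (projected AdaTD(0), Markovian observation).** Let $s_1,s_2,\dots$ be a Markov chain with transition matrix $\mathcal P$ and arbitrary initial law. Start from a deterministic $\theta^1$ with $\|\theta^1\|\le R$, and from $m^0=0$, $v^0=0$; for $k\ge 1$ put $$g^k=\bigl(\mathcal R(s_k,s_{k+1})+\gamma\phi(s_{k+1})^\top\theta^k-\phi(s_k)^\top\theta^k\bigr)\phi(s_k),\qquad m^k=\beta m^{k-1}+(1-\beta)g^k,$$ $$v^k=v^{k-1}+\|g^k\|^2,\qquad \theta^{k+1}=\mathrm{Proj}_R\bigl(\theta^k+\eta\, m^k/\sqrt{v^k+\delta}\bigr),$$ where $\mathrm{Proj}_R$ is the Euclidean projection onto the closed ball of radius $R$ about the origin. **Theorem 1.** Let $R>0$, $R\ge \dfrac{2B}{\sqrt\omega\,(1-\gamma)^{3/2}}$, $\eta>0$, $\delta>0$, $0\le\beta<1$, and put $G=2R+B$, $$C_1=\frac{16(\ln K/\ln\frac1\rho)^2G}{\sqrt\delta(1-\gamma)^2\omega^2}+\frac{2\eta\beta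 G}{(1-\beta)(1-\gamma)\omega}+\frac{\eta G}{(1-\gamma)\omega}+\frac{4RG^2}{(1-\gamma)\omega\delta},$$ $$C_2=\frac{4R^2G}{(1-\gamma)\omega\eta}+\frac{4R\eta G^2}{\sqrt\delta(1-\beta)(1-\gamma)\omega}+\frac{4R\bar\kappa(B+R\gamma+R)G}{\sqrt\delta(1-\gamma)\omega}.$$ (a) For all sufficiently large $K$ (beyond a threshold that depends only on $B,\gamma,\omega,\bar\kappa,\rho,R,\eta,\delta,\beta$), $$\min_{1\le k\le K}\mathbb E\|\theta^*-\theta^k\|^2\le\Bigl[C_1\ln\Bigl(\frac{\delta+KG^2}{\delta}\Bigr)+C_2\Bigr]\Big/\sqrt K .$$ (b) $C_1=O\bigl((\ln K/\ln\frac1\rho)^2/\sqrt\delta\bigr)$ as $K\to\infty$, with an implied constant that does not depend on $\delta,\rho,K$; and $C_2=O(1/\sqrt\delta)$ as $\delta\to 0^+$. (c) $\tilde O\bigl(\varepsilon^{-2}\ln^4\frac1\varepsilon/\ln^4\frac1\rho\bigr)$ iterations reach accuracy $\varepsilon$: with $b=\ln^4\frac1\varepsilon/(\varepsilon^2\ln^4\frac1\rho)$,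 there are $C>0$ and $p\in\mathbb N$, depending only on $B,\gamma,\omega,\bar\kappa,R,\eta,\delta,\beta$, such that for every $\rho_0\in(0,1)$ there is $\varepsilon_0\in(0,1)$, depending only on these parameters and on $\rho_0$, such that for all $\rho\in[\rho_0,1)$ and $\varepsilon\in(0,\varepsilon_0)$, every $K\ge 1$ with $K\ge C\,b\,(\ln b)^p$ satisfies $\min_{1\le k\le K}\mathbb E\|\theta^*-\theta^k\|^2\le\varepsilon$. -/

import Mathlib

open Filter Topology MeasureTheory Asymptotics

universe u v

noncomputable section

namespace AdaTD

/-- A finite-state Markov reward process (the decision process with its policy fixed) together with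
a feature map: transition matrix, transition rewards, limiting distribution, feature vectors. -/
structure Model (S : Type u) (d : ℕ) where
  P : Matrix S S ℝ
  reward : S → S → ℝ
  stat : S → ℝ
  feature : S → EuclideanSpace ℝ (Fin d)

namespace Model

variable {S : Type u} {d : ℕ} (M : Model S d)

/-- The feature matrix, whose rows are the feature vectors. -/
def featureMatrix : Matrix S (Fin d) ℝ := Matrix.of fun s j => M.feature s j

/-- The linear approximation `V_θ(s) = φ(s)ᵀ θ`. -/
def value (θ : EuclideanSpace ℝ (Fin d)) (s : S) : ℝ := inner ℝ (M.feature s) θ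

/-- The Bellman operator
`(T V)(s) = ∑ s', P(s' | s) R(s, s') + γ ∑ s', P(s' | s) V(s')`. -/
def bellman [Fintype S] (γ : ℝ) (V : S → ℝ) (s : S) : ℝ :=
  ∑ s', M.P s s' * M.reward s s' + γ * ∑ s', M.P s s' * V s'

/-- The square of the norm `‖V‖_π`. -/
def statNormSq [Fintype S] (V : S → ℝ) : ℝ := ∑ s, M.stat s * V s ^ 2

/-- `θ` solves the projected Bellman equation `Φ θ = Proj_Φ (T Φ θ)`: the vector `Φ θ` is the point
of the column span of `Φ` that is nearest to `T Φ θ` in the norm `‖·‖_π`. -/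
def IsProjectedBellmanSolution [Fintype S] (γ : ℝ) (θ : EuclideanSpace ℝ (Fin d)) : Prop :=
  ∀ θ' : EuclideanSpace ℝ (Fin d),
    M.statNormSq (M.value θ - M.bellman γ (M.value θ)) ≤
      M.statNormSq (M.value θ' - M.bellman γ (M.value θ))

/-- The standing assumptions, with reward bound `B`, mixing constants `κ`, `ρ`, and `ω` the least
eigenvalue of `Φᵀ Diag(π) Φ`. -/
structure Assumptions [Fintype S] [DecidableEq S] (B κ ρ ω : ℝ) : Prop where
  P_nonneg : ∀ s s', 0 ≤ M.P s s'
  P_sum : ∀ s, ∑ s', M.P s s' = 1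
  reward_bound : ∀ s s', |M.reward s s'| ≤ B
  stat_lim : ∀ s s', Tendsto (fun t : ℕ => (M.P ^ t) s s') atTop (𝓝 (M.stat s'))
  stat_pos : ∀ s, 0 < M.stat s
  mixing : ∀ (t : ℕ) (s : S), ∑ s', |(M.P ^ t) s s' - M.stat s'| ≤ κ * ρ ^ t
  feature_bound : ∀ s, ‖M.feature s‖ ≤ 1
  full_rank : M.featureMatrix.rank = d
  least_eigenvalue :
    IsLeast {x : ℝ | Module.End.HasEigenvalue
      (Matrix.toLin' (M.featureMatrix.transpose * Matrix.diagonal M.stat * M.featureMatrix)) x} ω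

/-- The stochastic semi-gradient
`(R(s, s') + γ V_θ(s') - V_θ(s)) φ(s)`. -/
def semiGrad (γ : ℝ) (θ : EuclideanSpace ℝ (Fin d)) (s s' : S) : EuclideanSpace ℝ (Fin d) :=
  (M.reward s s' + γ * M.value θ s' - M.value θ s) • M.feature s

end Model

/-- Euclidean projection onto the closed ball of radius `R` about the origin. -/
def projBall {d : ℕ} (R : ℝ) (y : EuclideanSpace ℝ (Fin d)) : EuclideanSpace ℝ (Fin d) :=
  if ‖y‖ ≤ R then y else (R / ‖y‖) • y

/-- The memory of the algorithm after some iterations: next iterate `θ`, momentum `m`,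
accumulated squared norms `v`. -/
structure Memory (d : ℕ) where
  θ : EuclideanSpace ℝ (Fin d)
  m : EuclideanSpace ℝ (Fin d)
  v : ℝ

/-- Projected AdaTD(0) run along the trajectory `x 1, x 2, …` from the initial iterate `θ₁`;
`run … k` holds `θ^(k+1)`, `m^k` and `v^k`. -/
def run {S : Type u} {d : ℕ} (M : Model S d) (γ R η δ β : ℝ) (θ₁ : EuclideanSpace ℝ (Fin d))
    (x : ℕ → S) : ℕ → Memory d
  | 0 => ⟨θ₁, 0, 0⟩
  | k + 1 =>
    let prev := run M γ R η δ β θ₁ x k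
    let g := M.semiGrad γ prev.θ (x (k + 1)) (x (k + 2))
    let m := β • prev.m + (1 - β) • g
    let v := prev.v + ‖g‖ ^ 2
    ⟨projBall R (prev.θ + (η / √(v + δ)) • m), m, v⟩

/-- The iterate `θ^k`, for `k ≥ 1`. -/
def iterate {S : Type u} {d : ℕ} (M : Model S d) (γ R η δ β : ℝ) (θ₁ : EuclideanSpace ℝ (Fin d))
    (x : ℕ → S) (k : ℕ) : EuclideanSpace ℝ (Fin d) :=
  (run M γ R η δ β θ₁ x (k - 1)).θ

/-- Markovian observation: `s 1, s 2, …` is a Markov chain with transition matrix `P` and arbitrary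
initial law, described by its finite-dimensional distributions (`s 0` is not used). -/
structure IsMarkovChain {S : Type u} [MeasurableSpace S] {Ω : Type v} [MeasurableSpace Ω]
    (P : Matrix S S ℝ) (μ : Measure Ω) (s : ℕ → Ω → S) : Prop where
  measurable : ∀ k, Measurable (s k)
  law : ∀ (n : ℕ) (x : ℕ → S), 1 ≤ n →
    μ.real {w | ∀ i ∈ Finset.Icc 1 n, s i w = x i} =
      μ.real {w | s 1 w = x 1} * ∏ i ∈ Finset.Ico 1 n, P (x i) (x (i + 1))

/-- `min_{1 ≤ k ≤ K} E ‖θ* - θ^k‖²`. -/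
def minError {S : Type u} {d : ℕ} {Ω : Type v} [MeasurableSpace Ω] (M : Model S d)
    (γ R η δ β : ℝ) (θ₁ θstar : EuclideanSpace ℝ (Fin d)) (μ : Measure Ω) (s : ℕ → Ω → S)
    (K : ℕ) (hK : 1 ≤ K) : ℝ :=
  (Finset.Icc 1 K).inf' (Finset.nonempty_Icc.2 hK) fun k =>
    ∫ w, ‖θstar - iterate M γ R η δ β θ₁ (fun i => s i w) k‖ ^ 2 ∂μ

/-- `G = 2R + B`. -/
def G (B R : ℝ) : ℝ := 2 * R + B

def C₁ (B γ ω ρ R η δ β : ℝ) (K : ℕ) : ℝ :=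
  16 * (Real.log K / Real.log (1 / ρ)) ^ 2 * G B R / (√δ * (1 - γ) ^ 2 * ω ^ 2)
    + 2 * η * β * G B R / ((1 - β) * (1 - γ) * ω)
    + η * G B R / ((1 - γ) * ω)
    + 4 * R * G B R ^ 2 / ((1 - γ) * ω * δ)

def C₂ (B γ ω κ R η δ β : ℝ) : ℝ :=
  4 * R ^ 2 * G B R / ((1 - γ) * ω * η)
    + 4 * R * η * G B R ^ 2 / (√δ * (1 - β) * (1 - γ) * ω)
    + 4 * R * κ * (B + R * γ + R) * G B R / (√δ * (1 - γ) * ω)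

/-- `ln⁴(1/ε) / (ε² ln⁴(1/ρ))`. -/
def complexity (ε ρ : ℝ) : ℝ :=
  Real.log (1 / ε) ^ 4 / (ε ^ 2 * Real.log (1 / ρ) ^ 4)

end AdaTD

end

/-! Along every trajectory, adaptive gradient steps with momentum have regret O(√K) against any
fixed point z of the ball (`sum_inner_g_le`). Take z = θ*, which lies in the ball by
`norm_solution_le`. Under a stationary transition the semi-gradient at θ points towards θ*: its mean
inner product with θ* - θ is at least (1 - γ) ω ‖θ* - θ‖² (`meanProgress_ge`,
`statNormSq_value_ge`). If each transition were stationary and independent of the current iterate,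
the regret divided by K would therefore bound the error.

Markovian dependence is handled by a delay τ. The iterate at time j is paired with the transition τ
steps later, which is stationary given the past up to an error κ ρ^τ (`integral_stationary_sub_le`).
Exchanging the iterate at time j + τ for the one at time j costs the drift between them; the squared
steps sum to O(ln K) only, so for τ ≤ K the total drift is O(τ √K ln K) (`sum_norm_drift_le`). With
τ ≈ ln K / ln(1/ρ) this yields the explicit rate `minError_le`, of order ln² K / √K.

Part (a) is then a comparison of orders: C₁ ln((δ + K G²)/δ) grows like ln³ K, so it eventually
dominates the explicit rate whatever the constants are. Part (c) inverts the explicit rate, whose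
dependence on ρ is kept visible. -/

noncomputable section

namespace AdaTD

/-! ### Euclidean projection onto the ball. -/

section Projection

variable {d : ℕ} {R : ℝ}

theorem norm_projBall_le (hR : 0 < R) (y : EuclideanSpace ℝ (Fin d)) : ‖projBall R y‖ ≤ R := by
  unfold projBall
  split_ifs with h
  · exact h
  · push Not at h
    have hy : 0 < ‖y‖ := hR.trans h
    rw [norm_smul, Real.norm_eq_abs, abs_of_pos (by positivity), div_mul_cancel₀ _ hy.ne']

/-- With t = R/‖y‖, expanding the squares and applying Cauchy-Schwarz to ⟨y, z⟩ leaves 2(‖y‖R - R²)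
≤ ‖y‖² - R², that is (‖y‖ - R)² ≥ 0. -/
theorem norm_projBall_sub_le (hR : 0 < R) (y z : EuclideanSpace ℝ (Fin d)) (hz : ‖z‖ ≤ R) :
    ‖projBall R y - z‖ ≤ ‖y - z‖ := by
  unfold projBall
  split_ifs with h
  · exact le_rfl
  · push Not at h
    have hy : 0 < ‖y‖ := hR.trans h
    refine le_of_sq_le_sq ?_ (norm_nonneg _)
    rw [norm_sub_sq_real, norm_sub_sq_real, norm_smul, inner_smul_left, Real.norm_eq_abs,
      abs_of_pos (by positivity), div_mul_cancel₀ _ hy.ne']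
    simp only [conj_trivial]
    have h1 : inner ℝ y z ≤ ‖y‖ * R :=
      (real_inner_le_norm y z).trans (mul_le_mul_of_nonneg_left hz hy.le)
    have ht : R / ‖y‖ ≤ 1 := (div_le_one hy).2 h.le
    have h2 : R / ‖y‖ * ‖y‖ = R := div_mul_cancel₀ _ hy.ne'
    have h3 := mul_le_mul_of_nonneg_left h1 (sub_nonneg.2 ht)
    have h4 : (1 - R / ‖y‖) * (‖y‖ * R) = ‖y‖ * R - R ^ 2 := by
      field_simp
    nlinarith [sq_nonneg (‖y‖ - R)]

end Projection

/-! ### Pathwise regret and step-length bounds for the adaptive momentum recursion. -/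

/-- A momentum recursion with adaptive step sizes, driven by the directions `g` and projected onto
the ball of radius `R`; the directions are bounded by `Γ`. -/
structure IsAdaptiveMomentum {d : ℕ} (R η δ β Γ : ℝ) (θ m g : ℕ → EuclideanSpace ℝ (Fin d))
    (v : ℕ → ℝ) : Prop where
  norm_θ_zero : ‖θ 0‖ ≤ R
  m_zero : m 0 = 0
  v_zero : v 0 = 0
  θ_succ : ∀ n, θ (n + 1) = projBall R (θ n + (η / √(v (n + 1) + δ)) • m (n + 1))
  m_succ : ∀ n, m (n + 1) = β • m n + (1 - β) • g n
  v_succ : ∀ n, v (n + 1) = v n + ‖g n‖ ^ 2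
  norm_g_le : ∀ n, ‖g n‖ ≤ Γ

/-- A moving average started at zero cannot accumulate more than its inputs. This transfers bounds
on the directions `g` to the momentum. -/
theorem sum_succ_le_of_le_convex_comb {β : ℝ} (hβ₀ : 0 ≤ β) (hβ₁ : β < 1) {p q : ℕ → ℝ}
    (hq₀ : q 0 = 0) (hq : ∀ n, 0 ≤ q n) (h : ∀ n, q (n + 1) ≤ β * q n + (1 - β) * p n) (N : ℕ) :
    ∑ n ∈ Finset.range N, q (n + 1) ≤ ∑ n ∈ Finset.range N, p n := by
  -- The extra term β q_N is the mass still held by the average; with it the induction closes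
  -- exactly.
  have key : (1 - β) * ∑ n ∈ Finset.range N, q (n + 1) + β * q N ≤
      (1 - β) * ∑ n ∈ Finset.range N, p n := by
    induction N with
    | zero => simp [hq₀]
    | succ N ih =>
      rw [Finset.sum_range_succ, Finset.sum_range_succ]
      linarith [h N]
  have := mul_nonneg hβ₀ (hq N)
  exact le_of_mul_le_mul_left (by linarith) (sub_pos.2 hβ₁)

namespace IsAdaptiveMomentum

variable {d : ℕ} {R η δ β Γ : ℝ} {θ m g : ℕ → EuclideanSpace ℝ (Fin d)} {v : ℕ → ℝ}

theorem norm_θ_le (h : IsAdaptiveMomentum R η δ β Γ θ m g v) (hR : 0 < R) (n : ℕ) : ‖θ n‖ ≤ R := by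
  cases n with
  | zero => exact h.norm_θ_zero
  | succ n => rw [h.θ_succ]; exact norm_projBall_le hR _

theorem v_nonneg (h : IsAdaptiveMomentum R η δ β Γ θ m g v) (n : ℕ) : 0 ≤ v n := by
  induction n with
  | zero => exact h.v_zero.ge
  | succ n ih => rw [h.v_succ]; positivity

theorem v_le (h : IsAdaptiveMomentum R η δ β Γ θ m g v) (n : ℕ) : v n ≤ n * Γ ^ 2 := by
  induction n with
  | zero => simp [h.v_zero]
  | succ n ih =>
    rw [h.v_succ]
    have := pow_le_pow_left₀ (norm_nonneg _) (h.norm_g_le n) 2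
    push_cast
    linarith

theorem Γ_nonneg (h : IsAdaptiveMomentum R η δ β Γ θ m g v) : 0 ≤ Γ :=
  (norm_nonneg _).trans (h.norm_g_le 0)

theorem norm_m_le (h : IsAdaptiveMomentum R η δ β Γ θ m g v) (hβ₀ : 0 ≤ β) (hβ₁ : β < 1) (n : ℕ) :
    ‖m n‖ ≤ Γ := by
  induction n with
  | zero => simpa [h.m_zero] using h.Γ_nonneg
  | succ n ih =>
    rw [h.m_succ]
    refine (norm_add_le _ _).trans ?_
    rw [norm_smul, norm_smul, Real.norm_of_nonneg hβ₀, Real.norm_of_nonneg (sub_pos.2 hβ₁).le]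
    have := mul_le_mul_of_nonneg_left ih hβ₀
    have := mul_le_mul_of_nonneg_left (h.norm_g_le n) (sub_pos.2 hβ₁).le
    linarith

theorem norm_m_succ_sq_le (h : IsAdaptiveMomentum R η δ β Γ θ m g v) (hβ₀ : 0 ≤ β) (hβ₁ : β < 1)
    (n : ℕ) : ‖m (n + 1)‖ ^ 2 ≤ β * ‖m n‖ ^ 2 + (1 - β) * ‖g n‖ ^ 2 := by
  have h1 : ‖m (n + 1)‖ ≤ β * ‖m n‖ + (1 - β) * ‖g n‖ := by
    rw [h.m_succ]
    refine (norm_add_le _ _).trans ?_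
    rw [norm_smul, norm_smul, Real.norm_of_nonneg hβ₀, Real.norm_of_nonneg (sub_pos.2 hβ₁).le]
  have h2 := pow_le_pow_left₀ (norm_nonneg _) h1 2
  nlinarith [mul_nonneg (mul_nonneg hβ₀ (sub_pos.2 hβ₁).le) (sq_nonneg (‖m n‖ - ‖g n‖))]

/-- Because the weights do not increase, a_n‖m_n‖² itself obeys the moving-average inequality. -/
theorem sum_weighted_norm_m_sq_le (h : IsAdaptiveMomentum R η δ β Γ θ m g v) (hβ₀ : 0 ≤ β)
    (hβ₁ : β < 1) {a : ℕ → ℝ} (ha : ∀ n, 0 ≤ a n) (ha' : ∀ n, a (n + 1) ≤ a n) (N : ℕ) :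
    ∑ n ∈ Finset.range N, a (n + 1) * ‖m (n + 1)‖ ^ 2 ≤
      ∑ n ∈ Finset.range N, a (n + 1) * ‖g n‖ ^ 2 := by
  refine sum_succ_le_of_le_convex_comb (q := fun n => a n * ‖m n‖ ^ 2)
    (p := fun n => a (n + 1) * ‖g n‖ ^ 2) hβ₀ hβ₁ (by simp [h.m_zero])
    (fun n => mul_nonneg (ha n) (sq_nonneg _)) (fun n => ?_) N
  have h1 := mul_le_mul_of_nonneg_left (h.norm_m_succ_sq_le hβ₀ hβ₁ n) (ha (n + 1))
  have h2 := mul_le_mul_of_nonneg_right (ha' n) (mul_nonneg hβ₀ (sq_nonneg ‖m n‖))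
  linarith

theorem stepSize_succ_le (h : IsAdaptiveMomentum R η δ β Γ θ m g v) (hη : 0 < η) (hδ : 0 < δ)
    (n : ℕ) : η / √(v (n + 1) + δ) ≤ η / √(v n + δ) := by
  have h0 := h.v_nonneg n
  have h1 : v n ≤ v (n + 1) := by rw [h.v_succ]; linarith [sq_nonneg ‖g n‖]
  gcongr

/-- Once `m` is replaced by `g`, the sum telescopes: with p² and q² the successive values of v + δ,
(q² - p²)/q ≤ 2(q - p). -/
theorem sum_stepSize_mul_norm_m_sq_le (h : IsAdaptiveMomentum R η δ β Γ θ m g v) (hβ₀ : 0 ≤ β)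
    (hβ₁ : β < 1) (hη : 0 < η) (hδ : 0 < δ) (N : ℕ) :
    ∑ n ∈ Finset.range N, η / √(v (n + 1) + δ) * ‖m (n + 1)‖ ^ 2 ≤ 2 * η * √(v N + δ) := by
  refine (h.sum_weighted_norm_m_sq_le hβ₀ hβ₁ (a := fun n => η / √(v n + δ))
    (fun n => by positivity) (h.stepSize_succ_le hη hδ) N).trans ?_
  induction N with
  | zero => simp; positivity
  | succ N ih =>
    rw [Finset.sum_range_succ]
    refine (add_le_add_left ih _).trans ?_
    have h0 := h.v_nonneg N
    have h1 := h.v_nonneg (N + 1)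
    set p := √(v N + δ)
    set q := √(v (N + 1) + δ)
    have hp : p ^ 2 = v N + δ := Real.sq_sqrt (by positivity)
    have hq : q ^ 2 = v (N + 1) + δ := Real.sq_sqrt (by positivity)
    have hq0 : 0 < q := Real.sqrt_pos.2 (by positivity)
    have hg : ‖g N‖ ^ 2 = q ^ 2 - p ^ 2 := by rw [hp, hq, h.v_succ]; ring
    rw [hg]
    have : 2 * η * q - 2 * η * p - η / q * (q ^ 2 - p ^ 2) = η / q * (q - p) ^ 2 := by
      field_simp; ring
    have : 0 ≤ η / q * (q - p) ^ 2 := by positivity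
    linarith

theorem norm_step_le (h : IsAdaptiveMomentum R η δ β Γ θ m g v) (hR : 0 < R) (hη : 0 < η) (n : ℕ) :
    ‖θ (n + 1) - θ n‖ ≤ η / √(v (n + 1) + δ) * ‖m (n + 1)‖ := by
  rw [h.θ_succ]
  refine (norm_projBall_sub_le hR _ _ (h.norm_θ_le hR n)).trans ?_
  rw [add_sub_cancel_left, norm_smul, Real.norm_of_nonneg (by positivity)]

/-- The squared step sizes are η²/(v + δ), so after passing from `m` to `g` each term is η²(1 - p/q)
≤ η² ln(q/p), where p and q are successive values of v + δ; the logarithms telescope. -/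
theorem sum_norm_step_sq_le (h : IsAdaptiveMomentum R η δ β Γ θ m g v) (hβ₀ : 0 ≤ β)
    (hβ₁ : β < 1) (hR : 0 < R) (hη : 0 < η) (hδ : 0 < δ) (N : ℕ) :
    ∑ n ∈ Finset.range N, ‖θ (n + 1) - θ n‖ ^ 2 ≤ η ^ 2 * Real.log ((δ + N * Γ ^ 2) / δ) := by
  have hs : ∀ n, (η / √(v n + δ)) ^ 2 = η ^ 2 / (v n + δ) := fun n => by
    have := h.v_nonneg n
    rw [div_pow, Real.sq_sqrt (by positivity)]
  have h1 : ∑ n ∈ Finset.range N, ‖θ (n + 1) - θ n‖ ^ 2 ≤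
      ∑ n ∈ Finset.range N, (η / √(v (n + 1) + δ)) ^ 2 * ‖m (n + 1)‖ ^ 2 :=
    Finset.sum_le_sum fun n _ => by
      rw [← mul_pow]
      exact pow_le_pow_left₀ (norm_nonneg _) (h.norm_step_le hR hη n) 2
  refine h1.trans ((h.sum_weighted_norm_m_sq_le hβ₀ hβ₁ (a := fun n => (η / √(v n + δ)) ^ 2)
    (fun n => by positivity) (fun n => pow_le_pow_left₀ (by positivity)
      (h.stepSize_succ_le hη hδ n) 2) N).trans ?_)
  have h2 : ∀ M : ℕ, ∑ n ∈ Finset.range M, (η / √(v (n + 1) + δ)) ^ 2 * ‖g n‖ ^ 2 ≤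
      η ^ 2 * Real.log ((v M + δ) / δ) := by
    intro M
    induction M with
    | zero => simp [h.v_zero, hδ.ne']
    | succ M ih =>
      rw [Finset.sum_range_succ]
      refine (add_le_add_left ih _).trans ?_
      have h0 := h.v_nonneg M
      have h1 := h.v_nonneg (M + 1)
      have hp : 0 < v M + δ := by positivity
      have hq : 0 < v (M + 1) + δ := by positivity
      have hg : ‖g M‖ ^ 2 = (v (M + 1) + δ) - (v M + δ) := by rw [h.v_succ]; ring
      have hl := Real.log_le_sub_one_of_pos (div_pos hp hq)
      rw [Real.log_div hp.ne' hq.ne'] at hl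
      rw [hs, hg, Real.log_div hp.ne' hδ.ne', Real.log_div hq.ne' hδ.ne']
      have he : η ^ 2 / (v (M + 1) + δ) * (v (M + 1) + δ - (v M + δ)) =
          η ^ 2 * (1 - (v M + δ) / (v (M + 1) + δ)) := by field_simp
      rw [he, ← mul_add]
      gcongr
      linarith
  refine (h2 N).trans ?_
  have := h.v_nonneg N
  have hv := h.v_le N
  have hle : v N + δ ≤ δ + N * Γ ^ 2 := by linarith
  gcongr

/-- The online gradient descent argument: expand ‖θ_{n+1} - z‖² using nonexpansiveness of the
projection, then sum with the inverse step sizes as weights. -/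
theorem sum_inner_m_le (h : IsAdaptiveMomentum R η δ β Γ θ m g v) (hβ₀ : 0 ≤ β)
    (hβ₁ : β < 1) (hR : 0 < R) (hη : 0 < η) (hδ : 0 < δ) {z : EuclideanSpace ℝ (Fin d)}
    (hz : ‖z‖ ≤ R) (N : ℕ) :
    ∑ n ∈ Finset.range N, inner ℝ (m (n + 1)) (z - θ n) ≤
      (2 * R ^ 2 / η + η) * √(v N + δ) := by
  have step : ∀ n, inner ℝ (m (n + 1)) (z - θ n) ≤
      (‖θ n - z‖ ^ 2 - ‖θ (n + 1) - z‖ ^ 2) * (√(v (n + 1) + δ) / (2 * η)) +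
        1 / 2 * (η / √(v (n + 1) + δ) * ‖m (n + 1)‖ ^ 2) := by
    intro n
    have h1 := pow_le_pow_left₀ (norm_nonneg _)
      (norm_projBall_sub_le hR (θ n + (η / √(v (n + 1) + δ)) • m (n + 1)) z hz) 2
    rw [← h.θ_succ] at h1
    have hv := h.v_nonneg (n + 1)
    set q := √(v (n + 1) + δ)
    have hq : 0 < q := Real.sqrt_pos.2 (by positivity)
    have h2 : ‖θ n + (η / q) • m (n + 1) - z‖ ^ 2 =
        ‖θ n - z‖ ^ 2 - 2 * (η / q) * inner ℝ (m (n + 1)) (z - θ n)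
          + (η / q) ^ 2 * ‖m (n + 1)‖ ^ 2 := by
      have : θ n + (η / q) • m (n + 1) - z = (θ n - z) + (η / q) • m (n + 1) := by abel
      rw [this, norm_add_sq_real, norm_smul, inner_smul_right, mul_pow, Real.norm_eq_abs, sq_abs,
        ← neg_sub z (θ n), inner_neg_left, norm_neg, real_inner_comm]
      ring
    rw [h2] at h1
    have h3 : 2 * (η / q) * inner ℝ (m (n + 1)) (z - θ n) ≤
        ‖θ n - z‖ ^ 2 - ‖θ (n + 1) - z‖ ^ 2 + (η / q) ^ 2 * ‖m (n + 1)‖ ^ 2 := by linarith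
    have h4 := mul_le_mul_of_nonneg_right h3 (show 0 ≤ q / (2 * η) by positivity)
    calc inner ℝ (m (n + 1)) (z - θ n)
        = 2 * (η / q) * inner ℝ (m (n + 1)) (z - θ n) * (q / (2 * η)) := by field_simp
      _ ≤ _ := h4
      _ = _ := by field_simp
  have hD : ∀ n, ‖θ n - z‖ ^ 2 ≤ 4 * R ^ 2 := fun n => by
    have h1 : ‖θ n - z‖ ≤ 2 * R := (norm_sub_le _ _).trans (by linarith [h.norm_θ_le hR n])
    nlinarith [norm_nonneg (θ n - z)]
  -- Summation by parts with nondecreasing weights; the unused part of the squared diameter 4R² is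
  -- carried along to pay for each increase of the weight.
  have abel : ∀ M : ℕ, ∑ n ∈ Finset.range M,
      (‖θ n - z‖ ^ 2 - ‖θ (n + 1) - z‖ ^ 2) * (√(v (n + 1) + δ) / (2 * η)) ≤
        (4 * R ^ 2 - ‖θ M - z‖ ^ 2) * (√(v M + δ) / (2 * η)) := by
    intro M
    induction M with
    | zero => simpa using mul_nonneg (sub_nonneg.2 (hD 0)) (by positivity)
    | succ M ih =>
      rw [Finset.sum_range_succ]
      have hv : v M ≤ v (M + 1) := by rw [h.v_succ]; linarith [sq_nonneg ‖g M‖]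
      have : √(v M + δ) / (2 * η) ≤ √(v (M + 1) + δ) / (2 * η) := by gcongr
      have := mul_le_mul_of_nonneg_left this (sub_nonneg.2 (hD M))
      linarith
  refine (Finset.sum_le_sum fun n _ => step n).trans ?_
  rw [Finset.sum_add_distrib, ← Finset.mul_sum]
  have h1 := abel N
  have h2 := h.sum_stepSize_mul_norm_m_sq_le hβ₀ hβ₁ hη hδ N
  have h3 : (4 * R ^ 2 - ‖θ N - z‖ ^ 2) * (√(v N + δ) / (2 * η)) ≤
      4 * R ^ 2 * (√(v N + δ) / (2 * η)) := by
    gcongr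
    linarith [sq_nonneg ‖θ N - z‖]
  have h4 : 4 * R ^ 2 * (√(v N + δ) / (2 * η)) = 2 * R ^ 2 / η * √(v N + δ) := by
    field_simp; ring
  linarith

/-- The regret bound of the adaptive momentum recursion. -/
theorem sum_inner_g_le (h : IsAdaptiveMomentum R η δ β Γ θ m g v) (hβ₀ : 0 ≤ β)
    (hβ₁ : β < 1) (hR : 0 < R) (hη : 0 < η) (hδ : 0 < δ) {z : EuclideanSpace ℝ (Fin d)}
    (hz : ‖z‖ ≤ R) (N : ℕ) :
    ∑ n ∈ Finset.range N, inner ℝ (g n) (z - θ n) ≤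
      (2 * R ^ 2 / η + η + (2 * η + 2 * R * Γ / √δ) / (1 - β)) * √(δ + N * Γ ^ 2) := by
  have hβ' : 0 < 1 - β := sub_pos.2 hβ₁
  have hΓ := h.Γ_nonneg
  -- Solving the momentum recursion for (1 - β) g_n leaves a telescoping difference of ⟨m_n, z -
  -- θ_n⟩, up to the displacement θ_{n+1} - θ_n.
  have drift : ∀ n, (1 - β) * inner ℝ (g n) (z - θ n) ≤
      (1 - β) * inner ℝ (m (n + 1)) (z - θ n) +
      β * (inner ℝ (m (n + 1)) (z - θ (n + 1)) - inner ℝ (m n) (z - θ n)) +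
      β * (η / √(v (n + 1) + δ) * ‖m (n + 1)‖ ^ 2) := by
    intro n
    have h1 : inner ℝ (m (n + 1)) (z - θ n) =
        β * inner ℝ (m n) (z - θ n) + (1 - β) * inner ℝ (g n) (z - θ n) := by
      rw [h.m_succ, inner_add_left, real_inner_smul_left, real_inner_smul_left]
    have h2 : inner ℝ (m (n + 1)) (z - θ n) = inner ℝ (m (n + 1)) (z - θ (n + 1)) +
        inner ℝ (m (n + 1)) (θ (n + 1) - θ n) := by
      rw [← inner_add_right]; congr 1; abel
    have h3 : inner ℝ (m (n + 1)) (θ (n + 1) - θ n) ≤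
        η / √(v (n + 1) + δ) * ‖m (n + 1)‖ ^ 2 := by
      refine (real_inner_le_norm _ _).trans ?_
      have := mul_le_mul_of_nonneg_left (h.norm_step_le hR hη n) (norm_nonneg (m (n + 1)))
      linarith
    have h4 := mul_le_mul_of_nonneg_left h3 hβ₀
    have h5 := congrArg (β * ·) h2
    linarith
  have hsum := Finset.sum_le_sum fun n (_ : n ∈ Finset.range N) => drift n
  rw [← Finset.mul_sum, Finset.sum_add_distrib, Finset.sum_add_distrib, ← Finset.mul_sum,
    ← Finset.mul_sum, ← Finset.mul_sum, Finset.sum_range_sub (fun n => inner ℝ (m n) (z - θ n)),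
    h.m_zero, inner_zero_left, sub_zero] at hsum
  have hX := h.sum_inner_m_le hβ₀ hβ₁ hR hη hδ hz N
  have hQ := h.sum_stepSize_mul_norm_m_sq_le hβ₀ hβ₁ hη hδ N
  have hv := h.v_nonneg N
  have hsq : √(v N + δ) ≤ √(δ + N * Γ ^ 2) := Real.sqrt_le_sqrt (by linarith [h.v_le N])
  have hsδ : √δ ≤ √(δ + N * Γ ^ 2) := Real.sqrt_le_sqrt (by have : 0 ≤ N * Γ ^ 2 := by positivity
                                                            linarith)
  set q := √(δ + N * Γ ^ 2)
  have hδ' : 0 < √δ := Real.sqrt_pos.2 hδ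
  have hq : 0 < q := hδ'.trans_le hsδ
  have hz : inner ℝ (m N) (z - θ N) ≤ 2 * R * Γ / √δ * q := by
    have h1 : ‖z - θ N‖ ≤ 2 * R := (norm_sub_le _ _).trans (by linarith [h.norm_θ_le hR N])
    have h2 : inner ℝ (m N) (z - θ N) ≤ Γ * (2 * R) := (real_inner_le_norm _ _).trans
      (mul_le_mul (h.norm_m_le hβ₀ hβ₁ N) h1 (norm_nonneg _) hΓ)
    -- The boundary term is bounded by 2RΓ alone; √δ ≤ q rewrites it as a multiple of q, whence the
    -- 1/√δ in the coefficient.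
    have h3 : 2 * R * Γ / √δ * √δ ≤ 2 * R * Γ / √δ * q := by gcongr
    rw [div_mul_cancel₀ _ hδ'.ne'] at h3
    linarith
  have hX' : (2 * R ^ 2 / η + η) * √(v N + δ) ≤ (2 * R ^ 2 / η + η) * q := by gcongr
  have hQ' : 2 * η * √(v N + δ) ≤ 2 * η * q := by gcongr
  have e1 := mul_le_mul_of_nonneg_left (hX.trans hX') hβ'.le
  have e2 : β * inner ℝ (m N) (z - θ N) ≤ 2 * R * Γ / √δ * q := by
    have h0 : 0 ≤ 2 * R * Γ / √δ * q := by positivity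
    have := mul_le_mul_of_nonneg_left hz hβ₀
    have := mul_le_mul_of_nonneg_right hβ₁.le h0
    linarith
  have e3 : β * ∑ n ∈ Finset.range N, η / √(v (n + 1) + δ) * ‖m (n + 1)‖ ^ 2 ≤ 2 * η * q := by
    have h0 : 0 ≤ 2 * η * q := by positivity
    have := mul_le_mul_of_nonneg_left (hQ.trans hQ') hβ₀
    have := mul_le_mul_of_nonneg_right hβ₁.le h0
    linarith
  refine le_of_mul_le_mul_left ?_ hβ'
  have : (1 - β) * ((2 * R ^ 2 / η + η + (2 * η + 2 * R * Γ / √δ) / (1 - β)) * q) =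
      (1 - β) * ((2 * R ^ 2 / η + η) * q) + (2 * η * q + 2 * R * Γ / √δ * q) := by
    field_simp
  linarith

end IsAdaptiveMomentum

/-! ### Geometry of the semi-gradient under the stationary law. -/

namespace Model

variable {S : Type u} {d : ℕ} (M : Model S d)

/-- The inner product of the semi-gradient at `θ` with the direction from `θ` to `z`. -/
def progress (γ : ℝ) (z θ : EuclideanSpace ℝ (Fin d)) (s s' : S) : ℝ :=
  inner ℝ (M.semiGrad γ θ s s') (z - θ)

/-- The expectation of `progress` over a stationary transition. -/
def meanProgress [Fintype S] (γ : ℝ) (z θ : EuclideanSpace ℝ (Fin d)) : ℝ :=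
  ∑ s, ∑ s', M.stat s * (M.P s s' * M.progress γ z θ s s')

theorem progress_eq (γ : ℝ) (z θ : EuclideanSpace ℝ (Fin d)) (s s' : S) :
    M.progress γ z θ s s' =
      (M.reward s s' + γ * M.value θ s' - M.value θ s) * M.value (z - θ) s := by
  rw [progress, semiGrad, real_inner_smul_left, value, value, value]

theorem value_add (θ θ' : EuclideanSpace ℝ (Fin d)) (s : S) :
    M.value (θ + θ') s = M.value θ s + M.value θ' s := inner_add_right _ _ _

theorem value_sub (θ θ' : EuclideanSpace ℝ (Fin d)) (s : S) :
    M.value (θ - θ') s = M.value θ s - M.value θ' s := inner_sub_right _ _ _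

theorem value_smul (c : ℝ) (θ : EuclideanSpace ℝ (Fin d)) (s : S) :
    M.value (c • θ) s = c * M.value θ s := real_inner_smul_right _ _ _

theorem value_eq_mulVec (θ : EuclideanSpace ℝ (Fin d)) :
    M.value θ = M.featureMatrix.mulVec θ.ofLp := by
  ext s
  simp only [value, featureMatrix, Matrix.mulVec, dotProduct, Matrix.of_apply, PiLp.inner_apply,
    RCLike.inner_apply, conj_trivial]
  exact Finset.sum_congr rfl fun i _ => mul_comm _ _

namespace Assumptions

variable [Fintype S] [DecidableEq S] {M} {B κ ρ ω : ℝ}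

theorem reward_bound_nonneg [Nonempty S] (h : M.Assumptions B κ ρ ω) : 0 ≤ B :=
  (abs_nonneg _).trans (h.reward_bound (Classical.arbitrary S) (Classical.arbitrary S))

theorem abs_value_le (h : M.Assumptions B κ ρ ω) (θ : EuclideanSpace ℝ (Fin d)) (s : S) :
    |M.value θ s| ≤ ‖θ‖ := by
  refine (abs_real_inner_le_norm _ _).trans ?_
  simpa using mul_le_mul_of_nonneg_right (h.feature_bound s) (norm_nonneg θ)

theorem abs_tdError_le (h : M.Assumptions B κ ρ ω) {γ R : ℝ} (hγ₀ : 0 < γ) (hγ₁ : γ < 1)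
    {θ : EuclideanSpace ℝ (Fin d)} (hθ : ‖θ‖ ≤ R) (s s' : S) :
    |M.reward s s' + γ * M.value θ s' - M.value θ s| ≤ G B R := by
  have h1 := (h.abs_value_le θ s).trans hθ
  have h2 : |γ * M.value θ s'| ≤ R := by
    rw [abs_mul, abs_of_pos hγ₀]
    have := (h.abs_value_le θ s').trans hθ
    have := mul_le_mul hγ₁.le this (abs_nonneg _) zero_le_one
    linarith
  have h3 := h.reward_bound s s'
  rw [abs_le] at *
  unfold G
  constructor <;> linarith [h1.1, h1.2, h2.1, h2.2, h3.1, h3.2]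

theorem norm_semiGrad_le (h : M.Assumptions B κ ρ ω) {γ R : ℝ} (hγ₀ : 0 < γ) (hγ₁ : γ < 1)
    {θ : EuclideanSpace ℝ (Fin d)} (hθ : ‖θ‖ ≤ R) (s s' : S) :
    ‖M.semiGrad γ θ s s'‖ ≤ G B R := by
  have h1 := h.abs_tdError_le hγ₀ hγ₁ hθ s s'
  rw [semiGrad, norm_smul, Real.norm_eq_abs]
  have := mul_le_mul h1 (h.feature_bound s) (norm_nonneg _) ((abs_nonneg _).trans h1)
  linarith

theorem abs_progress_le (h : M.Assumptions B κ ρ ω) {γ R : ℝ} (hγ₀ : 0 < γ) (hγ₁ : γ < 1)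
    {z θ : EuclideanSpace ℝ (Fin d)} (hz : ‖z‖ ≤ R) (hθ : ‖θ‖ ≤ R) (s s' : S) :
    |M.progress γ z θ s s'| ≤ 2 * R * G B R := by
  have h1 := h.norm_semiGrad_le hγ₀ hγ₁ hθ s s'
  have h2 : ‖z - θ‖ ≤ 2 * R := (norm_sub_le _ _).trans (by linarith)
  refine (abs_real_inner_le_norm _ _).trans ?_
  have := mul_le_mul h1 h2 (norm_nonneg _) ((norm_nonneg _).trans h1)
  linarith

/-- The quantity is a product of the temporal-difference error and the value of z - θ. The first
factor is 2-Lipschitz, the second 1-Lipschitz, and both are at most G, hence 3G. -/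
theorem abs_progress_sub_le [Nonempty S] (h : M.Assumptions B κ ρ ω) {γ R : ℝ} (hγ₀ : 0 < γ)
    (hγ₁ : γ < 1) {z θ θ' : EuclideanSpace ℝ (Fin d)} (hz : ‖z‖ ≤ R) (hθ : ‖θ‖ ≤ R)
    (hθ' : ‖θ'‖ ≤ R) (s s' : S) :
    |M.progress γ z θ s s' - M.progress γ z θ' s s'| ≤ 3 * G B R * ‖θ - θ'‖ := by
  have hB := h.reward_bound_nonneg
  have h1 := h.abs_tdError_le hγ₀ hγ₁ hθ' s s'
  have h2 : |M.value (z - θ) s| ≤ G B R := (h.abs_value_le _ s).trans <|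
    (norm_sub_le _ _).trans (by unfold G; linarith)
  have h3 := h.abs_value_le (θ - θ') s
  have h4 : |γ * M.value (θ - θ') s' - M.value (θ - θ') s| ≤ 2 * ‖θ - θ'‖ := by
    refine (abs_sub _ _).trans ?_
    rw [abs_mul, abs_of_pos hγ₀]
    have := mul_le_mul hγ₁.le (h.abs_value_le (θ - θ') s') (abs_nonneg _) zero_le_one
    linarith
  have e : M.progress γ z θ s s' - M.progress γ z θ' s s' =
      (γ * M.value (θ - θ') s' - M.value (θ - θ') s) * M.value (z - θ) s -
      (M.reward s s' + γ * M.value θ' s' - M.value θ' s) * M.value (θ - θ') s := by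
    simp only [progress_eq, value_sub]; ring
  rw [e]
  refine (abs_sub _ _).trans ?_
  rw [abs_mul, abs_mul]
  have h5 := mul_le_mul h4 h2 (abs_nonneg _) (by positivity)
  have h6 := mul_le_mul h1 h3 (abs_nonneg _) ((abs_nonneg _).trans h1)
  linarith

theorem stat_sum [Nonempty S] (h : M.Assumptions B κ ρ ω) : ∑ s, M.stat s = 1 := by
  have s₀ := Classical.arbitrary S
  have hpow : ∀ t : ℕ, ∀ s, ∑ s', (M.P ^ t) s s' = 1 := by
    intro t
    induction t with
    | zero => intro s; simp [Matrix.one_apply]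
    | succ t ih =>
      intro s
      simp only [pow_succ, Matrix.mul_apply]
      rw [Finset.sum_comm]
      simp only [← Finset.mul_sum, h.P_sum, mul_one, ih]
  have h1 : Tendsto (fun t : ℕ => ∑ s', (M.P ^ t) s₀ s') atTop (𝓝 (∑ s', M.stat s')) :=
    tendsto_finsetSum _ fun s' _ => h.stat_lim s₀ s'
  simp only [hpow] at h1
  exact tendsto_nhds_unique h1 tendsto_const_nhds

theorem stat_stationary [Nonempty S] (h : M.Assumptions B κ ρ ω) (s' : S) :
    ∑ s, M.stat s * M.P s s' = M.stat s' := by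
  have s₀ := Classical.arbitrary S
  have h1 : Tendsto (fun t : ℕ => ∑ s, (M.P ^ t) s₀ s * M.P s s') atTop
      (𝓝 (∑ s, M.stat s * M.P s s')) :=
    tendsto_finsetSum _ fun s _ => (h.stat_lim s₀ s).mul_const _
  have h2 := (h.stat_lim s₀ s').comp (tendsto_add_atTop_nat 1)
  refine tendsto_nhds_unique h1 (h2.congr fun t => ?_)
  simp [pow_succ, Matrix.mul_apply]

theorem statNormSq_nonneg (h : M.Assumptions B κ ρ ω) (V : S → ℝ) : 0 ≤ M.statNormSq V :=
  Finset.sum_nonneg fun s _ => mul_nonneg (h.stat_pos s).le (sq_nonneg _)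

/-- The normal equations of the projection, obtained from minimality along the line z + t w. -/
theorem sum_bellman_residual_mul_value (h : M.Assumptions B κ ρ ω) {γ : ℝ}
    {z : EuclideanSpace ℝ (Fin d)} (hz : M.IsProjectedBellmanSolution γ z)
    (w : EuclideanSpace ℝ (Fin d)) :
    ∑ s, M.stat s * ((M.bellman γ (M.value z) s - M.value z s) * M.value w s) = 0 := by
  set b := ∑ s, M.stat s * ((M.bellman γ (M.value z) s - M.value z s) * M.value w s)
  have key : ∀ t : ℝ, 0 ≤ t ^ 2 * M.statNormSq (M.value w) - 2 * t * b := by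
    intro t
    have h1 := hz (z + t • w)
    have h2 : M.statNormSq (M.value (z + t • w) - M.bellman γ (M.value z)) =
        M.statNormSq (M.value z - M.bellman γ (M.value z)) +
          (t ^ 2 * M.statNormSq (M.value w) - 2 * t * b) := by
      simp only [statNormSq, b, Finset.mul_sum, ← Finset.sum_add_distrib, ← Finset.sum_sub_distrib,
        Pi.sub_apply, value_add, value_smul]
      exact Finset.sum_congr rfl fun s _ => by ring
    linarith
  have ha := h.statNormSq_nonneg (M.value w)
  set a := M.statNormSq (M.value w)
  -- The optimal t would be b/a; a + 1 avoids the case a = 0 and still makes the quadratic negative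
  -- unless b = 0.
  have h1 := key (b / (a + 1))
  have ha1 : 0 < a + 1 := by positivity
  have e : (b / (a + 1)) ^ 2 * a - 2 * (b / (a + 1)) * b = - (b ^ 2 * ((a + 2) / (a + 1) ^ 2)) := by
    field_simp; ring
  rw [e] at h1
  have h2 : 0 < (a + 2) / (a + 1) ^ 2 := by positivity
  have h3 : b ^ 2 ≤ 0 := by
    by_contra hb
    push Not at hb
    linarith [mul_pos hb h2]
  exact pow_eq_zero_iff two_ne_zero |>.1 (le_antisymm h3 (sq_nonneg b))

/-- With u the value of z - θ, the progress is (residual at z)·u(s) + u(s)² - γ u(s)u(s'). The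
residual averages to zero by orthogonality, u(s)u(s') ≤ (u(s)² + u(s')²)/2, and stationarity gives
both squares the same mean. -/
theorem meanProgress_ge [Nonempty S] (h : M.Assumptions B κ ρ ω) {γ : ℝ} (hγ₀ : 0 < γ)
    {z : EuclideanSpace ℝ (Fin d)} (hz : M.IsProjectedBellmanSolution γ z)
    (θ : EuclideanSpace ℝ (Fin d)) :
    (1 - γ) * M.statNormSq (M.value (z - θ)) ≤ M.meanProgress γ z θ := by
  have h0 := h.sum_bellman_residual_mul_value hz (z - θ)
  set u := M.value (z - θ) with hu
  have hres : ∑ s, ∑ s', M.stat s * (M.P s s' *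
      ((M.reward s s' + γ * M.value z s' - M.value z s) * u s)) = 0 := by
    rw [← h0]
    refine Finset.sum_congr rfl fun s _ => ?_
    rw [← Finset.mul_sum]
    congr 1
    have : ∑ s', M.P s s' * ((M.reward s s' + γ * M.value z s' - M.value z s) * u s) =
        (∑ s', M.P s s' * M.reward s s' + γ * ∑ s', M.P s s' * M.value z s' -
          (∑ s', M.P s s') * M.value z s) * u s := by
      rw [Finset.mul_sum, Finset.sum_mul, ← Finset.sum_add_distrib, ← Finset.sum_sub_distrib,
        Finset.sum_mul]
      exact Finset.sum_congr rfl fun s' _ => by ring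
    rw [this, h.P_sum, one_mul, bellman]
  have hleft : ∑ s, ∑ s', M.stat s * (M.P s s' * u s ^ 2) = M.statNormSq u := by
    refine Finset.sum_congr rfl fun s _ => ?_
    rw [← Finset.mul_sum, ← Finset.sum_mul, h.P_sum, one_mul]
  have hright : ∑ s, ∑ s', M.stat s * (M.P s s' * u s' ^ 2) = M.statNormSq u := by
    rw [Finset.sum_comm]
    refine Finset.sum_congr rfl fun s' _ => ?_
    simp only [← mul_assoc]
    rw [← Finset.sum_mul, h.stat_stationary]
  have hpt : ∀ s s', M.stat s * (M.P s s' * ((1 - γ / 2) * u s ^ 2 - γ / 2 * u s' ^ 2 +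
      (M.reward s s' + γ * M.value z s' - M.value z s) * u s)) ≤
        M.stat s * (M.P s s' * M.progress γ z θ s s') := by
    intro s s'
    refine mul_le_mul_of_nonneg_left (mul_le_mul_of_nonneg_left ?_ (h.P_nonneg s s'))
      (h.stat_pos s).le
    have e : M.progress γ z θ s s' = (M.reward s s' + γ * M.value z s' - M.value z s) * u s
        + u s ^ 2 - γ * (u s * u s') := by
      rw [progress_eq, hu]; simp only [value_sub]; ring
    rw [e]
    nlinarith [mul_nonneg hγ₀.le (sq_nonneg (u s - u s'))]
  have hsum := Finset.sum_le_sum fun s (_ : s ∈ Finset.univ) =>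
    Finset.sum_le_sum fun s' (_ : s' ∈ Finset.univ) => hpt s s'
  refine le_trans (le_of_eq ?_) hsum
  have e : ∀ s s', M.stat s * (M.P s s' * ((1 - γ / 2) * u s ^ 2 - γ / 2 * u s' ^ 2 +
      (M.reward s s' + γ * M.value z s' - M.value z s) * u s)) =
      (1 - γ / 2) * (M.stat s * (M.P s s' * u s ^ 2)) -
      γ / 2 * (M.stat s * (M.P s s' * u s' ^ 2)) +
      M.stat s * (M.P s s' * ((M.reward s s' + γ * M.value z s' - M.value z s) * u s)) :=
    fun s s' => by ring
  simp only [e, Finset.sum_add_distrib, Finset.sum_sub_distrib, ← Finset.mul_sum] at *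
  rw [hleft, hright, hres]
  ring

/-- The right side is the quadratic form of A = Φᵀ Diag(π) Φ. An eigenvalue of A - ωI shifted by ω
is one of A, so A - ωI is positive semidefinite. -/
theorem statNormSq_value_ge (h : M.Assumptions B κ ρ ω) (θ : EuclideanSpace ℝ (Fin d)) :
    ω * ‖θ‖ ^ 2 ≤ M.statNormSq (M.value θ) := by
  set A := M.featureMatrix.transpose * Matrix.diagonal M.stat * M.featureMatrix with hA
  have hAH : A.IsHermitian := by
    rw [Matrix.IsHermitian, hA, Matrix.conjTranspose_eq_transpose_of_trivial]
    simp [Matrix.transpose_mul, Matrix.mul_assoc]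
  have hBH : (A - ω • (1 : Matrix (Fin d) (Fin d) ℝ)).IsHermitian := by
    refine hAH.sub ?_
    rw [Matrix.IsHermitian, Matrix.conjTranspose_eq_transpose_of_trivial]
    simp
  have hpos : (A - ω • (1 : Matrix (Fin d) (Fin d) ℝ)).PosSemidef := by
    rw [hBH.posSemidef_iff_eigenvalues_nonneg]
    intro i
    have h1 := hBH.mulVec_eigenvectorBasis i
    have hne : (hBH.eigenvectorBasis i).ofLp ≠ 0 := by
      intro h0
      have : hBH.eigenvectorBasis i = 0 := by ext j; simp [h0]
      exact hBH.eigenvectorBasis.orthonormal.ne_zero i this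
    have h2 : Module.End.HasEigenvalue (Matrix.toLin' A) (hBH.eigenvalues i + ω) := by
      refine Module.End.hasEigenvalue_of_hasEigenvector
        (x := (hBH.eigenvectorBasis i).ofLp) ⟨?_, hne⟩
      rw [Module.End.mem_eigenspace_iff, Matrix.toLin'_apply]
      rw [Matrix.sub_mulVec, Matrix.smul_mulVec, Matrix.one_mulVec] at h1
      rw [add_smul, ← h1]
      abel
    have := h.least_eigenvalue.2 h2
    simp only [Pi.zero_apply]
    linarith
  have h1 := hpos.dotProduct_mulVec_nonneg θ.ofLp
  rw [Matrix.sub_mulVec, Matrix.smul_mulVec, Matrix.one_mulVec, dotProduct_sub, dotProduct_smul,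
    star_trivial] at h1
  have h2 : θ.ofLp ⬝ᵥ θ.ofLp = ‖θ‖ ^ 2 := by
    rw [EuclideanSpace.norm_sq_eq]
    simp [dotProduct, sq]
  have h3 : θ.ofLp ⬝ᵥ A.mulVec θ.ofLp = M.statNormSq (M.value θ) := by
    rw [hA, ← Matrix.mulVec_mulVec, ← Matrix.mulVec_mulVec, ← value_eq_mulVec,
      Matrix.dotProduct_mulVec, Matrix.vecMul_transpose, ← value_eq_mulVec]
    simp only [dotProduct, statNormSq, Matrix.mulVec_diagonal]
    exact Finset.sum_congr rfl fun s _ => by ring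
  rw [h2, h3, smul_eq_mul] at h1
  linarith

/-- Contraction tested at θ = 0 gives (1 - γ)‖V‖_π ≤ B for V the value of z, hence ‖z‖ ≤ B/(√ω (1 -
γ)); the factor 2 and the exponent 3/2 are slack. -/
theorem norm_solution_le [Nonempty S] (h : M.Assumptions B κ ρ ω) {γ R : ℝ} (hγ₀ : 0 < γ)
    (hγ₁ : γ < 1) (hω : 0 < ω) (hR : 2 * B / (√ω * (1 - γ) ^ (3 / 2 : ℝ)) ≤ R)
    {z : EuclideanSpace ℝ (Fin d)} (hz : M.IsProjectedBellmanSolution γ z) : ‖z‖ ≤ R := by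
  have hB := h.reward_bound_nonneg
  have hg : 0 < 1 - γ := sub_pos.2 hγ₁
  have h1 := h.meanProgress_ge hγ₀ hz 0
  have hω' : 0 < √ω := Real.sqrt_pos.2 hω
  rw [sub_zero] at h1
  set q := √(M.statNormSq (M.value z))
  have hq : q ^ 2 = M.statNormSq (M.value z) := Real.sq_sqrt (h.statNormSq_nonneg _)
  have hq0 : 0 ≤ q := Real.sqrt_nonneg _
  have h2 : M.meanProgress γ z 0 ≤ B * ∑ s, M.stat s * |M.value z s| := by
    rw [meanProgress, Finset.mul_sum]
    refine Finset.sum_le_sum fun s _ => ?_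
    have e : B * (M.stat s * |M.value z s|) =
        ∑ s', M.stat s * (M.P s s' * (B * |M.value z s|)) := by
      rw [← Finset.mul_sum, ← Finset.sum_mul, h.P_sum]; ring
    rw [e]
    refine Finset.sum_le_sum fun s' _ => mul_le_mul_of_nonneg_left
      (mul_le_mul_of_nonneg_left ?_ (h.P_nonneg s s')) (h.stat_pos s).le
    rw [progress_eq, sub_zero]
    have e0 : ∀ s, M.value 0 s = 0 := fun s => inner_zero_right _
    rw [e0, e0, mul_zero, add_zero, sub_zero]
    refine (le_abs_self _).trans ?_
    rw [abs_mul]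
    exact mul_le_mul_of_nonneg_right (h.reward_bound s s') (abs_nonneg _)
  have h3 : ∑ s, M.stat s * |M.value z s| ≤ q := by
    refine Real.le_sqrt_of_sq_le ?_
    have hcs := Finset.sum_mul_sq_le_sq_mul_sq Finset.univ (fun s => √(M.stat s))
      (fun s => √(M.stat s) * |M.value z s|)
    have e1 : ∀ s, √(M.stat s) * (√(M.stat s) * |M.value z s|) = M.stat s * |M.value z s| :=
      fun s => by rw [← mul_assoc, Real.mul_self_sqrt (h.stat_pos s).le]
    have e2 : ∀ s, √(M.stat s) ^ 2 = M.stat s := fun s => Real.sq_sqrt (h.stat_pos s).le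
    simp only [e1, mul_pow, e2, sq_abs, h.stat_sum, one_mul] at hcs
    exact hcs
  have h4 : (1 - γ) * q ^ 2 ≤ B * q := by
    rw [hq]
    exact h1.trans (h2.trans (mul_le_mul_of_nonneg_left h3 hB))
  have h5 : (1 - γ) * q ≤ B := by
    rcases hq0.eq_or_lt with h0 | h0
    · rw [← h0]; simpa using hB
    · nlinarith
  have h6 : √ω * ‖z‖ ≤ q := by
    refine le_of_sq_le_sq ?_ hq0
    rw [mul_pow, Real.sq_sqrt hω.le, hq]
    exact h.statNormSq_value_ge z
  have h7 : (1 - γ) ^ (3 / 2 : ℝ) ≤ 1 - γ := by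
    simpa using Real.rpow_le_rpow_of_exponent_ge hg (by linarith)
      (show (1 : ℝ) ≤ 3 / 2 by norm_num)
  have hp : 0 < (1 - γ) ^ (3 / 2 : ℝ) := Real.rpow_pos_of_pos hg _
  refine le_trans ?_ hR
  rw [le_div_iff₀ (by positivity)]
  have h8 : ‖z‖ * (√ω * (1 - γ) ^ (3 / 2 : ℝ)) ≤ ‖z‖ * (√ω * (1 - γ)) := by gcongr
  have h9 := mul_le_mul_of_nonneg_left h6 hg.le
  linarith

end Assumptions
end Model

/-! ### Markov property and mixing from the finite-dimensional laws. -/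

namespace IsMarkovChain

variable {S : Type u} [Fintype S] [MeasurableSpace S] [MeasurableSingletonClass S]
  {Ω : Type v} [MeasurableSpace Ω] {μ : Measure Ω} [IsProbabilityMeasure μ] {P : Matrix S S ℝ}
  {s : ℕ → Ω → S}

/-- Such a function factors through the finite set of words of length n. -/
theorem integrable_of_dependsOn (h : IsMarkovChain P μ s) {n : ℕ} {F : (ℕ → S) → ℝ}
    (hF : DependsOn F (Set.Icc 1 n)) : Integrable (fun w => F fun i => s i w) μ := by
  obtain ⟨F', rfl⟩ := dependsOn_iff_exists_comp.1 hF
  have hY : Measurable fun w => (Set.Icc 1 n).domRestrict fun i => s i w :=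
    measurable_pi_iff.2 fun i => h.measurable i
  exact (Integrable.of_finite (μ := μ.map fun w => (Set.Icc 1 n).domRestrict fun i => s i w)
    (f := F')).comp_measurable hY

variable [DecidableEq S]

/-- The one-step Markov property. -/
theorem integral_mul_indicator_succ (h : IsMarkovChain P μ s) {n : ℕ} (hn : 1 ≤ n)
    {F : (ℕ → S) → ℝ} (hF : DependsOn F (Set.Icc 1 n)) (a : S) :
    ∫ w, F (fun i => s i w) * (if s (n + 1) w = a then 1 else 0) ∂μ =
      ∫ w, F (fun i => s i w) * P (s n w) a ∂μ := by
  classical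
  -- Words are padded with `a`, so the padded word already has the target state at position n + 1;
  -- the value at 0 plays no role.
  let ext : (Finset.Icc 1 n → S) → ℕ → S := fun y i =>
    if hi : i ∈ Finset.Icc 1 n then y ⟨i, hi⟩ else a
  have ext_of_mem : ∀ y i (hi : i ∈ Finset.Icc 1 n), ext y i = y ⟨i, hi⟩ := fun y i hi => dif_pos hi
  have ext_succ : ∀ y, ext y (n + 1) = a := fun y => dif_neg (by simp)
  let E : (ℕ → S) → ℕ → Set Ω := fun x k => {w | ∀ i ∈ Finset.Icc 1 k, s i w = x i}
  have hE : ∀ x k, MeasurableSet (E x k) := fun x k => by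
    have : E x k = ⋂ i ∈ Finset.Icc 1 k, s i ⁻¹' {x i} := by ext w; simp [E]
    rw [this]
    exact Finset.measurableSet_biInter _ fun i _ => h.measurable i (measurableSet_singleton _)
  have mem_E : ∀ y w, w ∈ E (ext y) n ↔ y = fun i : Finset.Icc 1 n => s i w := fun y w => by
    constructor
    · intro hw
      funext i
      rw [← ext_of_mem y i i.2, hw i i.2]
    · rintro rfl i hi
      exact (ext_of_mem (fun i : Finset.Icc 1 n => s i w) i hi).symm
  have F_ext : ∀ w, F (ext fun i : Finset.Icc 1 n => s i w) = F fun i => s i w := fun w =>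
    hF fun i hi => ext_of_mem (fun i : Finset.Icc 1 n => s i w) i (by simpa using hi)
  -- The cylinder events of words of length n partition Ω, and the integrand is constant on each.
  have expand : ∀ (f : S → ℝ) (w : Ω), F (fun i => s i w) * f (s n w) =
      ∑ y : Finset.Icc 1 n → S, (E (ext y) n).indicator (fun _ => F (ext y) * f (ext y n)) w := by
    intro f w
    rw [Finset.sum_eq_single (fun i : Finset.Icc 1 n => s i w)]
    · rw [Set.indicator_of_mem ((mem_E _ _).2 rfl), F_ext,
        ext_of_mem (fun i : Finset.Icc 1 n => s i w) n (Finset.mem_Icc.2 ⟨hn, le_rfl⟩)]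
    · intro y _ hy
      exact Set.indicator_of_notMem (fun hw => hy ((mem_E _ _).1 hw)) _
    · simp
  have expand' : ∀ w : Ω, F (fun i => s i w) * (if s (n + 1) w = a then 1 else 0) =
      ∑ y : Finset.Icc 1 n → S, (E (ext y) (n + 1)).indicator (fun _ => F (ext y)) w := by
    intro w
    have mem_E' : ∀ y, w ∈ E (ext y) (n + 1) ↔ w ∈ E (ext y) n ∧ s (n + 1) w = a := by
      intro y
      constructor
      · intro hw
        refine ⟨fun i hi => hw i (Finset.Icc_subset_Icc_right n.le_succ hi), ?_⟩
        rw [hw (n + 1) (by simp), ext_succ]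
      · rintro ⟨h1, h2⟩ i hi
        rcases (Finset.mem_Icc.1 hi).2.eq_or_lt with rfl | hlt
        · rw [h2, ext_succ]
        · exact h1 i (Finset.mem_Icc.2 ⟨(Finset.mem_Icc.1 hi).1, by omega⟩)
    have := expand (fun _ => if s (n + 1) w = a then 1 else 0) w
    rw [this]
    refine Finset.sum_congr rfl fun y _ => ?_
    simp only [Set.indicator_apply, mem_E']
    split_ifs <;> simp_all
  rw [integral_congr_ae (ae_of_all μ expand'),
    integral_congr_ae (ae_of_all μ (expand fun b => P b a)),
    integral_finsetSum _ fun y _ => (integrable_const _).indicator (hE _ _),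
    integral_finsetSum _ fun y _ => (integrable_const _).indicator (hE _ _)]
  refine Finset.sum_congr rfl fun y _ => ?_
  rw [integral_indicator_const _ (hE _ _), integral_indicator_const _ (hE _ _),
    h.law (n + 1) _ (by omega), h.law n _ hn, ← Finset.prod_Ico_mul_eq_prod_Ico_add_one hn,
    ext_succ, smul_eq_mul, smul_eq_mul]
  ring

/-- The Markov property over `t` steps. -/
theorem integral_mul_indicator_add (h : IsMarkovChain P μ s) {n : ℕ} (hn : 1 ≤ n)
    {F : (ℕ → S) → ℝ} (hF : DependsOn F (Set.Icc 1 n)) (t : ℕ) (a : S) :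
    ∫ w, F (fun i => s i w) * (if s (n + t) w = a then 1 else 0) ∂μ =
      ∫ w, F (fun i => s i w) * (P ^ t) (s n w) a ∂μ := by
  induction t generalizing a with
  | zero => simp [Matrix.one_apply]
  | succ t ih =>
    have hmono : DependsOn F (Set.Icc 1 (n + t)) :=
      hF.mono (Set.Icc_subset_Icc_right (by omega))
    have hint : ∀ (b : S) (m : ℕ) (hm : n ≤ m) (f : S → ℝ),
        Integrable (fun w => F (fun i => s i w) * f (s m w)) μ := by
      intro b m hm f
      refine h.integrable_of_dependsOn (n := m) (F := fun x => F x * f (x m)) ?_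
      intro x y hxy
      dsimp only
      rw [hF fun i hi => hxy i ⟨hi.1, hi.2.trans hm⟩, hxy m ⟨hn.trans hm, le_rfl⟩]
    have h1 := h.integral_mul_indicator_succ (n := n + t) (by omega) hmono a
    rw [← add_assoc, h1]
    have h2 : ∀ w, F (fun i => s i w) * P (s (n + t) w) a =
        ∑ b, P b a * (F (fun i => s i w) * (if s (n + t) w = b then 1 else 0)) := by
      intro w; simp [mul_comm]
    have h3 : ∀ w, F (fun i => s i w) * (P ^ (t + 1)) (s n w) a =
        ∑ b, P b a * (F (fun i => s i w) * (P ^ t) (s n w) b) := by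
      intro w
      rw [pow_succ, Matrix.mul_apply, Finset.mul_sum]
      exact Finset.sum_congr rfl fun b _ => by ring
    rw [integral_congr_ae (ae_of_all μ h2), integral_congr_ae (ae_of_all μ h3),
      integral_finsetSum _ fun b _ =>
        (hint b (n + t) (by omega) fun c => if c = b then 1 else 0).const_mul _,
      integral_finsetSum _ fun b _ => (hint b n le_rfl fun c => (P ^ t) c b).const_mul _]
    refine Finset.sum_congr rfl fun b _ => ?_
    rw [integral_const_mul, integral_const_mul, ih]

/-- Replacing the transition that follows `t` steps later by a stationary transition changes the
expectation of a function that is bounded by `c` by at most `c` times the distance to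
stationarity. -/
theorem integral_stationary_sub_le (h : IsMarkovChain P μ s) (hP : ∀ a b, 0 ≤ P a b)
    (hP₁ : ∀ a, ∑ b, P a b = 1) {n : ℕ} (hn : 1 ≤ n) {f : (ℕ → S) → S → S → ℝ}
    (hf : ∀ a b, DependsOn (fun x => f x a b) (Set.Icc 1 n)) {c : ℝ}
    (hc : ∀ x a b, |f x a b| ≤ c) {ν : S → ℝ} {t : ℕ} {ε : ℝ}
    (hmix : ∀ a, ∑ b, |(P ^ t) a b - ν b| ≤ ε) :
    ∫ w, ∑ a, ∑ b, ν a * (P a b * f (fun i => s i w) a b) ∂μ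
      - ∫ w, f (fun i => s i w) (s (n + t) w) (s (n + t + 1) w) ∂μ ≤ c * ε := by
  have hint : ∀ (a b : S) (k : ℝ) (g : S → ℝ),
      Integrable (fun w => k * (f (fun i => s i w) a b * g (s n w))) μ := by
    intro a b k g
    refine h.integrable_of_dependsOn (n := n) (F := fun x => k * (f x a b * g (x n))) ?_
    intro x y hxy
    have := hf a b hxy
    dsimp only at this ⊢
    rw [this, hxy n ⟨hn, le_rfl⟩]
  have hint' : ∀ (a b : S) (g : S → S → ℝ),
      Integrable (fun w => f (fun i => s i w) a b * g (s (n + t) w) (s (n + t + 1) w)) μ := by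
    intro a b g
    refine h.integrable_of_dependsOn (n := n + t + 1)
      (F := fun x => f x a b * g (x (n + t)) (x (n + t + 1))) ?_
    intro x y hxy
    have := hf a b fun i hi => hxy i ⟨hi.1, hi.2.trans (by omega)⟩
    dsimp only at this ⊢
    rw [this, hxy (n + t) ⟨by omega, by omega⟩, hxy (n + t + 1) ⟨by omega, le_rfl⟩]
  -- The Markov property is used twice: one step back from time n + t + 1, then t steps back to time
  -- n.
  have two : ∀ a b, ∫ w, f (fun i => s i w) a b *
      ((if s (n + t) w = a then 1 else 0) * (if s (n + t + 1) w = b then 1 else 0)) ∂μ =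
      ∫ w, P a b * (f (fun i => s i w) a b * (P ^ t) (s n w) a) ∂μ := by
    intro a b
    have hdep : DependsOn (fun x : ℕ → S => f x a b * (if x (n + t) = a then (1 : ℝ) else 0))
        (Set.Icc 1 (n + t)) := by
      intro x y hxy
      have := hf a b fun i hi => hxy i ⟨hi.1, hi.2.trans (by omega)⟩
      dsimp only at this ⊢
      rw [this, hxy (n + t) ⟨by omega, le_rfl⟩]
    have h1 := h.integral_mul_indicator_succ (by omega) hdep b
    simp only [← mul_assoc] at h1 ⊢
    rw [h1]
    have h2 := h.integral_mul_indicator_add hn (hf a b) t a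
    simp only [mul_assoc, integral_const_mul]
    rw [← h2, ← integral_const_mul]
    refine integral_congr_ae (ae_of_all μ fun w => ?_)
    dsimp only
    split_ifs with hw
    · rw [hw]; ring
    · simp
  have e1 : ∀ w, f (fun i => s i w) (s (n + t) w) (s (n + t + 1) w) = ∑ a, ∑ b,
      f (fun i => s i w) a b *
        ((if s (n + t) w = a then 1 else 0) * (if s (n + t + 1) w = b then 1 else 0)) := by
    intro w
    simp
  have e2 : ∫ w, f (fun i => s i w) (s (n + t) w) (s (n + t + 1) w) ∂μ =
      ∫ w, ∑ a, ∑ b, P a b * (f (fun i => s i w) a b * (P ^ t) (s n w) a) ∂μ := by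
    have hsum : ∀ {g : S → S → Ω → ℝ}, (∀ a b, Integrable (g a b) μ) →
        ∫ w, ∑ a, ∑ b, g a b w ∂μ = ∑ a, ∑ b, ∫ w, g a b w ∂μ := fun hg =>
      (integral_finsetSum _ fun a _ => integrable_finsetSum _ fun b _ => hg a b).trans
        (Finset.sum_congr rfl fun a _ => integral_finsetSum _ fun b _ => hg a b)
    refine (integral_congr_ae (ae_of_all μ e1)).trans ?_
    refine (hsum fun a b => hint' a b fun c d =>
      (if c = a then 1 else 0) * (if d = b then 1 else 0)).trans ?_
    refine Eq.trans ?_ (hsum fun a b => hint a b (P a b) fun c => (P ^ t) c a).symm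
    exact Finset.sum_congr rfl fun a _ => Finset.sum_congr rfl fun b _ => two a b
  have hint₁ : Integrable (fun w => ∑ a, ∑ b, ν a * (P a b * f (fun i => s i w) a b)) μ :=
    integrable_finsetSum _ fun a _ => integrable_finsetSum _ fun b _ => by
      simpa [mul_assoc] using hint a b (ν a * P a b) fun _ => 1
  have hint₂ : Integrable
      (fun w => ∑ a, ∑ b, P a b * (f (fun i => s i w) a b * (P ^ t) (s n w) a)) μ :=
    integrable_finsetSum _ fun a _ => integrable_finsetSum _ fun b _ =>
      hint a b _ fun c => (P ^ t) c a
  rw [e2, ← integral_sub hint₁ hint₂]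
  refine (integral_mono (hint₁.sub hint₂) (integrable_const (c * ε)) fun w => ?_).trans
    (by simp)
  dsimp only [Pi.sub_apply]
  rw [← Finset.sum_sub_distrib]
  have hc0 : 0 ≤ c := (abs_nonneg _).trans (hc (fun i => s i w) (s 0 w) (s 0 w))
  refine le_trans ?_ (mul_le_mul_of_nonneg_left (hmix (s n w)) hc0)
  rw [Finset.mul_sum]
  refine Finset.sum_le_sum fun a _ => ?_
  -- The row sum 1 of P spreads the bound over b, so the comparison can be made for each pair (a,
  -- b).
  have e3 : c * |(P ^ t) (s n w) a - ν a| = ∑ b, P a b * (c * |(P ^ t) (s n w) a - ν a|) := by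
    rw [← Finset.sum_mul, hP₁, one_mul]
  rw [e3, ← Finset.sum_sub_distrib]
  refine Finset.sum_le_sum fun b _ => ?_
  have e4 : ν a * (P a b * f (fun i => s i w) a b) -
      P a b * (f (fun i => s i w) a b * (P ^ t) (s n w) a) =
      P a b * (f (fun i => s i w) a b * (ν a - (P ^ t) (s n w) a)) := by ring
  rw [e4]
  refine mul_le_mul_of_nonneg_left ((le_abs_self _).trans ?_) (hP a b)
  rw [abs_mul, abs_sub_comm (ν a)]
  exact mul_le_mul_of_nonneg_right (hc _ a b) (abs_nonneg _)

end IsMarkovChain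

/-! ### The algorithm along a trajectory, and the drift of its iterates. -/

section Run

variable {S : Type u} {d : ℕ} (M : Model S d) (γ R η δ β : ℝ) (θ₁ : EuclideanSpace ℝ (Fin d))

/-- The n-th update reads the transition from `x n` to `x (n + 1)`, hence the window up to n + 1. -/
theorem run_congr {x y : ℕ → S} (n : ℕ) (hxy : ∀ i ∈ Set.Icc 1 (n + 1), x i = y i) :
    run M γ R η δ β θ₁ x n = run M γ R η δ β θ₁ y n := by
  induction n with
  | zero => rfl
  | succ n ih =>
    have h1 := ih fun i hi => hxy i ⟨hi.1, hi.2.trans (by omega)⟩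
    simp only [run]
    rw [h1, hxy (n + 1) ⟨by omega, by omega⟩, hxy (n + 2) ⟨by omega, by omega⟩]

theorem isAdaptiveMomentum_run [Fintype S] [DecidableEq S] {B κ ρ ω : ℝ}
    (hM : M.Assumptions B κ ρ ω) (hγ₀ : 0 < γ) (hγ₁ : γ < 1) (hR : 0 < R) (hθ₁ : ‖θ₁‖ ≤ R)
    (x : ℕ → S) :
    IsAdaptiveMomentum R η δ β (G B R) (fun n => (run M γ R η δ β θ₁ x n).θ)
      (fun n => (run M γ R η δ β θ₁ x n).m)
      (fun n => M.semiGrad γ (run M γ R η δ β θ₁ x n).θ (x (n + 1)) (x (n + 2)))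
      (fun n => (run M γ R η δ β θ₁ x n).v) where
  norm_θ_zero := hθ₁
  m_zero := rfl
  v_zero := rfl
  θ_succ _ := rfl
  m_succ _ := rfl
  v_succ _ := rfl
  norm_g_le n := by
    refine hM.norm_semiGrad_le hγ₀ hγ₁ ?_ _ _
    cases n with
    | zero => exact hθ₁
    | succ n => exact norm_projBall_le hR _

end Run

/-- The inequality a ≤ (1/√K + √K a²)/2 converts the logarithmic bound on squared steps into one on
lengths; the triangle inequality then adds up τ shifts. -/
theorem IsAdaptiveMomentum.sum_norm_drift_le {d : ℕ} {R η δ β Γ : ℝ}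
    {θ m g : ℕ → EuclideanSpace ℝ (Fin d)} {v : ℕ → ℝ}
    (h : IsAdaptiveMomentum R η δ β Γ θ m g v) (hβ₀ : 0 ≤ β) (hβ₁ : β < 1) (hR : 0 < R)
    (hη : 0 < η) (hδ : 0 < δ) {K : ℕ} (hK : 1 ≤ K) (τ : ℕ) :
    ∑ j ∈ Finset.range K, ‖θ (j + τ) - θ j‖ ≤
      τ * (√K * (1 + η ^ 2 * Real.log ((δ + (K + τ) * Γ ^ 2) / δ)) / 2) := by
  have hK' : 0 < √(K : ℝ) := Real.sqrt_pos.2 (by exact_mod_cast hK)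
  have hKK : √(K : ℝ) ^ 2 = K := Real.sq_sqrt (Nat.cast_nonneg K)
  have one : ∀ t, t ≤ τ → ∑ j ∈ Finset.range K, ‖θ (j + t + 1) - θ (j + t)‖ ≤
      √K * (1 + η ^ 2 * Real.log ((δ + (K + τ) * Γ ^ 2) / δ)) / 2 := by
    intro t ht
    have h1 : ∑ j ∈ Finset.range K, ‖θ (j + t + 1) - θ (j + t)‖ ^ 2 ≤
        η ^ 2 * Real.log ((δ + (K + τ) * Γ ^ 2) / δ) := by
      have h2 := h.sum_norm_step_sq_le hβ₀ hβ₁ hR hη hδ (t + K)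
      rw [Finset.sum_range_add] at h2
      have h3 : 0 ≤ ∑ n ∈ Finset.range t, ‖θ (n + 1) - θ n‖ ^ 2 :=
        Finset.sum_nonneg fun _ _ => sq_nonneg _
      have h4 : ∑ j ∈ Finset.range K, ‖θ (j + t + 1) - θ (j + t)‖ ^ 2 =
          ∑ j ∈ Finset.range K, ‖θ (t + j + 1) - θ (t + j)‖ ^ 2 :=
        Finset.sum_congr rfl fun j _ => by rw [add_comm j t]
      rw [h4]
      refine (show _ ≤ _ by linarith : _ ≤ η ^ 2 * Real.log ((δ + ↑(t + K) * Γ ^ 2) / δ)).trans ?_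
      have ht' : (t : ℝ) ≤ τ := by exact_mod_cast ht
      have h5 : ((t + K : ℕ) : ℝ) ≤ K + τ := by push_cast; linarith
      gcongr
    have h2 : ∀ a : ℝ, a ≤ (1 / √K + √K * a ^ 2) / 2 := by
      intro a
      have : (1 / √(K : ℝ) + √K * a ^ 2) / 2 - a = (1 - √K * a) ^ 2 / (2 * √K) := by
        field_simp; ring
      have : 0 ≤ (1 - √(K : ℝ) * a) ^ 2 / (2 * √K) := by positivity
      linarith
    refine (Finset.sum_le_sum fun j _ => h2 ‖θ (j + t + 1) - θ (j + t)‖).trans ?_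
    rw [← Finset.sum_div, Finset.sum_add_distrib, ← Finset.mul_sum, Finset.sum_const,
      Finset.card_range, nsmul_eq_mul]
    have h3 := mul_le_mul_of_nonneg_left h1 hK'.le
    have h4 : (K : ℝ) * (1 / √K) = √K := by
      nth_rewrite 1 [← hKK]; field_simp
    linarith
  have main : ∀ t, t ≤ τ → ∑ j ∈ Finset.range K, ‖θ (j + t) - θ j‖ ≤
      t * (√K * (1 + η ^ 2 * Real.log ((δ + (K + τ) * Γ ^ 2) / δ)) / 2) := by
    intro t
    induction t with
    | zero => simp
    | succ t ih =>
      intro ht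
      have h1 : ∀ j, ‖θ (j + (t + 1)) - θ j‖ ≤
          ‖θ (j + t + 1) - θ (j + t)‖ + ‖θ (j + t) - θ j‖ := fun j => by
        rw [← add_assoc]; exact norm_sub_le_norm_sub_add_norm_sub _ _ _
      refine (Finset.sum_le_sum fun j _ => h1 j).trans ?_
      rw [Finset.sum_add_distrib]
      have := one t (by omega)
      have := ih (by omega)
      push_cast
      linarith
  exact main τ le_rfl

theorem IsMarkovChain.nonempty {S : Type u} [MeasurableSpace S] {Ω : Type v} [MeasurableSpace Ω]
    {P : Matrix S S ℝ} {μ : Measure Ω} [IsProbabilityMeasure μ] {s : ℕ → Ω → S}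
    (_ : IsMarkovChain P μ s) : Nonempty S :=
  μ.nonempty_of_neZero.map (s 0)

/-! ### Regret, drift and mixing combined. -/

/-- The coefficient in the regret bound of the adaptive momentum recursion. -/
def regretConst (B R η δ β : ℝ) : ℝ :=
  2 * R ^ 2 / η + η + (2 * η + 2 * R * G B R / √δ) / (1 - β)

section Combination

variable {S : Type u} [Fintype S] [DecidableEq S] {d : ℕ} {M : Model S d} {B κ ρ ω : ℝ}

/-- The regret over τ + K steps loses its first τ terms, each at least -2RG; in the others the
iterate is moved back by τ at the Lipschitz cost 3G times the drift. -/
theorem Model.Assumptions.sum_progress_delayed_le [Nonempty S] (hM : M.Assumptions B κ ρ ω)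
    {γ R η δ β : ℝ} (hγ₀ : 0 < γ) (hγ₁ : γ < 1) (hR : 0 < R) (hη : 0 < η) (hδ : 0 < δ)
    (hβ₀ : 0 ≤ β) (hβ₁ : β < 1) {θ₁ z : EuclideanSpace ℝ (Fin d)} (hθ₁ : ‖θ₁‖ ≤ R)
    (hz : ‖z‖ ≤ R) (x : ℕ → S) {K : ℕ} (hK : 1 ≤ K) (τ : ℕ) :
    ∑ j ∈ Finset.range K,
        M.progress γ z (run M γ R η δ β θ₁ x j).θ (x (j + 1 + τ)) (x (j + 1 + τ + 1)) ≤
      regretConst B R η δ β * √(δ + (K + τ) * G B R ^ 2) + τ * (2 * R * G B R) +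
        3 * G B R * (τ * (√K * (1 + η ^ 2 * Real.log ((δ + (K + τ) * G B R ^ 2) / δ)) / 2)) := by
  have hG : 0 ≤ G B R := by have := hM.reward_bound_nonneg; unfold G; positivity
  have h := isAdaptiveMomentum_run M γ R η δ β θ₁ hM hγ₀ hγ₁ hR hθ₁ x
  have h1 := h.sum_inner_g_le hβ₀ hβ₁ hR hη hδ hz (τ + K)
  have h2 := h.sum_norm_drift_le hβ₀ hβ₁ hR hη hδ hK τ
  have hθ := h.norm_θ_le hR
  have hcast : ((τ + K : ℕ) : ℝ) = K + τ := by push_cast; ring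
  rw [Finset.sum_range_add, hcast] at h1
  have h3 : -(τ * (2 * R * G B R)) ≤ ∑ n ∈ Finset.range τ,
      inner ℝ (M.semiGrad γ (run M γ R η δ β θ₁ x n).θ (x (n + 1)) (x (n + 2)))
        (z - (run M γ R η δ β θ₁ x n).θ) := by
    have : ∑ n ∈ Finset.range τ, -(2 * R * G B R) ≤ ∑ n ∈ Finset.range τ,
        inner ℝ (M.semiGrad γ (run M γ R η δ β θ₁ x n).θ (x (n + 1)) (x (n + 2)))
          (z - (run M γ R η δ β θ₁ x n).θ) :=
      Finset.sum_le_sum fun n _ => (abs_le.1 (hM.abs_progress_le hγ₀ hγ₁ hz (hθ n) _ _)).1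
    simpa using this
  have h4 : ∀ j, M.progress γ z (run M γ R η δ β θ₁ x j).θ (x (j + 1 + τ)) (x (j + 1 + τ + 1)) ≤
      inner ℝ (M.semiGrad γ (run M γ R η δ β θ₁ x (τ + j)).θ (x (τ + j + 1)) (x (τ + j + 2)))
        (z - (run M γ R η δ β θ₁ x (τ + j)).θ) +
      3 * G B R * ‖(run M γ R η δ β θ₁ x (j + τ)).θ - (run M γ R η δ β θ₁ x j).θ‖ := by
    intro j
    have e1 : j + 1 + τ = τ + j + 1 := by omega
    have := hM.abs_progress_sub_le hγ₀ hγ₁ hz (hθ j) (hθ (τ + j)) (x (τ + j + 1)) (x (τ + j + 2))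
    rw [e1, add_comm j τ, norm_sub_rev]
    have := (abs_le.1 this).2
    unfold Model.progress at this ⊢
    linarith
  refine (Finset.sum_le_sum fun j _ => h4 j).trans ?_
  rw [Finset.sum_add_distrib, ← Finset.mul_sum]
  have h5 := mul_le_mul_of_nonneg_left h2 (show 0 ≤ 3 * G B R by positivity)
  unfold regretConst
  linarith

variable [MeasurableSpace S] [MeasurableSingletonClass S] {Ω : Type v} [MeasurableSpace Ω]
  {μ : Measure Ω} [IsProbabilityMeasure μ] {s : ℕ → Ω → S}

/-- The j-th iterate is a function of the states up to time j + 1, so the transition starting at j +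
1 + τ is τ steps beyond all it has seen. Taking expectations of the pathwise bound adds one mixing
error per step. -/
theorem mul_minError_le (hM : M.Assumptions B κ ρ ω) (hs : IsMarkovChain M.P μ s)
    {γ R η δ β : ℝ} (hγ₀ : 0 < γ) (hγ₁ : γ < 1) (hω : 0 < ω) (hR₀ : 0 < R)
    (hR : 2 * B / (√ω * (1 - γ) ^ (3 / 2 : ℝ)) ≤ R) (hη : 0 < η) (hδ : 0 < δ)
    (hβ₀ : 0 ≤ β) (hβ₁ : β < 1) {θ₁ z : EuclideanSpace ℝ (Fin d)} (hθ₁ : ‖θ₁‖ ≤ R)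
    (hz : M.IsProjectedBellmanSolution γ z) {K : ℕ} (hK : 1 ≤ K) (τ : ℕ) :
    (1 - γ) * ω * (K * minError M γ R η δ β θ₁ z μ s K hK) ≤
      regretConst B R η δ β * √(δ + (K + τ) * G B R ^ 2) + τ * (2 * R * G B R) +
        3 * G B R * (τ * (√K * (1 + η ^ 2 * Real.log ((δ + (K + τ) * G B R ^ 2) / δ)) / 2)) +
        K * (2 * R * G B R * (κ * ρ ^ τ)) := by
  have := hs.nonempty
  have hzR := hM.norm_solution_le hγ₀ hγ₁ hω hR hz
  have hg : 0 < 1 - γ := sub_pos.2 hγ₁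
  let θ : ℕ → (ℕ → S) → EuclideanSpace ℝ (Fin d) := fun j x => (run M γ R η δ β θ₁ x j).θ
  have hθ : ∀ j x, ‖θ j x‖ ≤ R := fun j x =>
    (isAdaptiveMomentum_run M γ R η δ β θ₁ hM hγ₀ hγ₁ hR₀ hθ₁ x).norm_θ_le hR₀ j
  have hdep : ∀ j, DependsOn (θ j) (Set.Icc 1 (j + 1)) := fun j x y hxy =>
    congrArg Memory.θ (run_congr M γ R η δ β θ₁ j hxy)
  have hint : ∀ j (F : EuclideanSpace ℝ (Fin d) → ℝ),
      Integrable (fun w => F (θ j fun i => s i w)) μ := fun j F =>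
    hs.integrable_of_dependsOn (n := j + 1) (F := fun x => F (θ j x)) fun x y hxy => by
      dsimp only; rw [hdep j hxy]
  have hstep : ∀ j, (1 - γ) * ω * ∫ w, ‖z - θ j fun i => s i w‖ ^ 2 ∂μ ≤
      ∫ w, M.progress γ z (θ j fun i => s i w) (s (j + 1 + τ) w) (s (j + 1 + τ + 1) w) ∂μ +
        2 * R * G B R * (κ * ρ ^ τ) := by
    intro j
    have h1 := hs.integral_stationary_sub_le hM.P_nonneg hM.P_sum (n := j + 1) (by omega)
      (f := fun x a b => M.progress γ z (θ j x) a b)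
      (fun a b x y hxy => by dsimp only; rw [hdep j hxy])
      (fun x a b => hM.abs_progress_le hγ₀ hγ₁ hzR (hθ j x) a b) (hM.mixing τ)
    have h2 : (1 - γ) * ω * ∫ w, ‖z - θ j fun i => s i w‖ ^ 2 ∂μ ≤
        ∫ w, M.meanProgress γ z (θ j fun i => s i w) ∂μ := by
      rw [← integral_const_mul]
      refine integral_mono (hint j fun ϑ => (1 - γ) * ω * ‖z - ϑ‖ ^ 2)
        (hint j fun ϑ => M.meanProgress γ z ϑ) fun w => ?_
      refine le_trans ?_ (hM.meanProgress_ge hγ₀ hz _)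
      rw [mul_assoc]
      exact mul_le_mul_of_nonneg_left (hM.statNormSq_value_ge _) hg.le
    have h3 : ∫ w, M.meanProgress γ z (θ j fun i => s i w) ∂μ = ∫ w, ∑ a, ∑ b,
        M.stat a * (M.P a b * M.progress γ z (θ j fun i => s i w) a b) ∂μ := rfl
    linarith
  have hsum : ∑ j ∈ Finset.range K,
      ∫ w, M.progress γ z (θ j fun i => s i w) (s (j + 1 + τ) w) (s (j + 1 + τ + 1) w) ∂μ ≤
      regretConst B R η δ β * √(δ + (K + τ) * G B R ^ 2) + τ * (2 * R * G B R) +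
        3 * G B R * (τ * (√K * (1 + η ^ 2 * Real.log ((δ + (K + τ) * G B R ^ 2) / δ)) / 2)) := by
    have hi : ∀ j, Integrable (fun w =>
        M.progress γ z (θ j fun i => s i w) (s (j + 1 + τ) w) (s (j + 1 + τ + 1) w)) μ := fun j =>
      hs.integrable_of_dependsOn (n := j + 1 + τ + 1)
        (F := fun x => M.progress γ z (θ j x) (x (j + 1 + τ)) (x (j + 1 + τ + 1)))
        fun x y hxy => by
          dsimp only
          rw [hdep j fun i hi => hxy i ⟨hi.1, hi.2.trans (by omega)⟩,
            hxy (j + 1 + τ) ⟨by omega, by omega⟩, hxy (j + 1 + τ + 1) ⟨by omega, le_rfl⟩]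
    rw [← integral_finsetSum _ fun j _ => hi j]
    refine (integral_mono (integrable_finsetSum _ fun j _ => hi j) (integrable_const _)
      fun w => hM.sum_progress_delayed_le hγ₀ hγ₁ hR₀ hη hδ hβ₀ hβ₁ hθ₁ hzR
        (fun i => s i w) hK τ).trans (by simp)
  have hmin : K * minError M γ R η δ β θ₁ z μ s K hK ≤
      ∑ j ∈ Finset.range K, ∫ w, ‖z - θ j fun i => s i w‖ ^ 2 ∂μ := by
    have : ∑ j ∈ Finset.range K, minError M γ R η δ β θ₁ z μ s K hK ≤
        ∑ j ∈ Finset.range K, ∫ w, ‖z - θ j fun i => s i w‖ ^ 2 ∂μ := by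
      refine Finset.sum_le_sum fun j hj => ?_
      -- `run` counts from 0 and `iterate` from 1, so j corresponds to k = j + 1.
      exact Finset.inf'_le (fun k => ∫ w, ‖z - iterate M γ R η δ β θ₁ (fun i => s i w) k‖ ^ 2 ∂μ)
        (b := j + 1) (Finset.mem_Icc.2 ⟨by omega, Finset.mem_range.1 hj⟩)
    simpa using this
  have h1 := mul_le_mul_of_nonneg_left hmin (mul_pos hg hω).le
  refine h1.trans ?_
  rw [Finset.mul_sum]
  refine (Finset.sum_le_sum fun j _ => hstep j).trans ?_
  rw [Finset.sum_add_distrib, Finset.sum_const, Finset.card_range, nsmul_eq_mul]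
  linarith

end Combination

/-! ### The explicit rate with its dependence on ρ. -/

/-- The coefficient of the rate in `minError_le`. -/
def rateConst (B γ ω κ R η δ β : ℝ) : ℝ :=
  (regretConst B R η δ β * √(δ + 2 * G B R ^ 2) + 2 * R * G B R +
    3 * G B R * ((1 + η ^ 2 * (2 + Real.log (1 + 2 * G B R ^ 2 / δ))) / 2) +
    2 * R * G B R * κ) / ((1 - γ) * ω)

theorem rateConst_nonneg {B γ ω κ R η δ β : ℝ} (hB : 0 ≤ B) (hγ₁ : γ < 1) (hω : 0 < ω)
    (hκ : 0 < κ) (hR₀ : 0 < R) (hη : 0 < η) (hδ : 0 < δ) (hβ₁ : β < 1) :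
    0 ≤ rateConst B γ ω κ R η δ β := by
  have hg : 0 < 1 - γ := sub_pos.2 hγ₁
  have hβ' : 0 < 1 - β := sub_pos.2 hβ₁
  have hG : 0 ≤ G B R := by unfold G; positivity
  have hlog : 0 ≤ Real.log (1 + 2 * G B R ^ 2 / δ) :=
    Real.log_nonneg (le_add_of_nonneg_right (by positivity))
  unfold rateConst regretConst
  positivity

/-- The explicit rate: up to a coefficient that does not depend on `ρ`, the error after `K`
iterations is at most `(1 + 1 / ln (1 / ρ))² (1 + ln K)² / √K`. -/
theorem minError_le {S : Type u} [Fintype S] [DecidableEq S] [MeasurableSpace S]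
    [MeasurableSingletonClass S] {d : ℕ} {M : Model S d} {B κ ρ ω : ℝ} {Ω : Type v}
    [MeasurableSpace Ω] {μ : Measure Ω} [IsProbabilityMeasure μ] {s : ℕ → Ω → S}
    (hM : M.Assumptions B κ ρ ω) (hs : IsMarkovChain M.P μ s)
    {γ R η δ β : ℝ} (hγ₀ : 0 < γ) (hγ₁ : γ < 1) (hω : 0 < ω) (hκ : 0 < κ) (hR₀ : 0 < R)
    (hR : 2 * B / (√ω * (1 - γ) ^ (3 / 2 : ℝ)) ≤ R) (hη : 0 < η) (hδ : 0 < δ)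
    (hβ₀ : 0 ≤ β) (hβ₁ : β < 1) (hρ₀ : 0 < ρ) (hρ₁ : ρ < 1)
    {θ₁ z : EuclideanSpace ℝ (Fin d)} (hθ₁ : ‖θ₁‖ ≤ R)
    (hz : M.IsProjectedBellmanSolution γ z) {K : ℕ} (hK : 1 ≤ K) :
    minError M γ R η δ β θ₁ z μ s K hK ≤ rateConst B γ ω κ R η δ β *
      ((1 + 1 / Real.log (1 / ρ)) * (1 + Real.log K)) ^ 2 / √K := by
  have := hs.nonempty
  have hB := hM.reward_bound_nonneg
  have hg : 0 < 1 - γ := sub_pos.2 hγ₁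
  have hβ' : 0 < 1 - β := sub_pos.2 hβ₁
  have hG : 0 ≤ G B R := by unfold G; positivity
  have hK1 : (1 : ℝ) ≤ K := by exact_mod_cast hK
  have hK0 : (0 : ℝ) < K := by linarith
  have hlK : 0 ≤ Real.log K := Real.log_nonneg hK1
  have hl : 0 < Real.log (1 / ρ) := Real.log_pos (one_lt_one_div hρ₀ hρ₁)
  set l := Real.log (1 / ρ) with hl_def
  set X := (1 + 1 / l) * (1 + Real.log K) with hX
  -- This delay makes K ρ^τ ≤ 1. `X` dominates 1, ln K and τ at once, and each error term is then
  -- compared with √K X².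
  set τ := ⌈Real.log K / l⌉₊ with hτ
  have hq1 : 1 ≤ √(K : ℝ) := Real.one_le_sqrt.2 hK1
  have hqq : √(K : ℝ) * √K = K := Real.mul_self_sqrt hK0.le
  set q := √(K : ℝ)
  have hXe : X = 1 + 1 / l + Real.log K + Real.log K / l := by rw [hX]; ring
  have hl1 : 0 ≤ 1 / l := by positivity
  have hl2 : 0 ≤ Real.log K / l := by positivity
  have hX1 : 1 ≤ X := by linarith
  have hτX : (τ : ℝ) ≤ X := by
    have := (Nat.ceil_lt_add_one hl2).le
    linarith
  have hlKX : Real.log K ≤ X := by linarith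
  have hXX : X ≤ X ^ 2 := by nlinarith
  have hρτ : K * ρ ^ τ ≤ 1 := by
    have h1 : Real.log K ≤ τ * l := by
      have := Nat.le_ceil (Real.log K / l)
      rwa [div_le_iff₀ hl] at this
    have h2 : Real.log (K * ρ ^ τ) ≤ 0 := by
      rw [Real.log_mul hK0.ne' (by positivity), Real.log_pow]
      have : Real.log ρ = -l := by rw [hl_def, one_div, Real.log_inv, neg_neg]
      rw [this]
      linarith
    exact (Real.log_nonpos_iff (by positivity)).1 h2
  have hKτ : (K : ℝ) + τ ≤ 2 * (K * X) := by
    have h1 : (K : ℝ) ≤ K * X := le_mul_of_one_le_right hK0.le hX1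
    have h2 : X ≤ K * X := le_mul_of_one_le_left (by linarith) hK1
    linarith
  have hKX : 1 ≤ K * X := one_le_mul_of_one_le_of_one_le hK1 hX1
  have hin : δ + (K + τ) * G B R ^ 2 ≤ K * X * (δ + 2 * G B R ^ 2) := by
    have h1 := mul_le_mul_of_nonneg_right hKτ (sq_nonneg (G B R))
    have h2 := mul_le_mul_of_nonneg_right hKX hδ.le
    linarith
  have hsqrt : √(δ + (K + τ) * G B R ^ 2) ≤ q * X ^ 2 * √(δ + 2 * G B R ^ 2) := by
    have h1 : √(K * X * (δ + 2 * G B R ^ 2)) = q * √X * √(δ + 2 * G B R ^ 2) := by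
      rw [Real.sqrt_mul (by positivity), Real.sqrt_mul hK0.le]
    have h2 : √X ≤ X ^ 2 := (Real.sqrt_le_sqrt hXX).trans (by
      rw [Real.sqrt_sq (by linarith)]; exact hXX)
    refine (Real.sqrt_le_sqrt hin).trans ?_
    rw [h1]
    gcongr
  set Λ := Real.log (1 + 2 * G B R ^ 2 / δ) with hΛ
  have hΛ0 : 0 ≤ Λ := Real.log_nonneg (le_add_of_nonneg_right (by positivity))
  have hlog : Real.log ((δ + (K + τ) * G B R ^ 2) / δ) ≤ X * (2 + Λ) := by
    have h1 : (δ + (K + τ) * G B R ^ 2) / δ ≤ K * X * (1 + 2 * G B R ^ 2 / δ) := by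
      rw [div_le_iff₀ hδ]
      refine hin.trans (le_of_eq ?_)
      field_simp
    have h2 := Real.log_le_log (by positivity) h1
    rw [Real.log_mul (by positivity) (by positivity), Real.log_mul hK0.ne' (by positivity)] at h2
    have h3 := Real.log_le_self (show 0 ≤ X by linarith)
    have h4 := mul_le_mul_of_nonneg_right hX1 hΛ0
    linarith
  have hX0 : 0 < X := by linarith
  have t1 : regretConst B R η δ β * √(δ + (K + τ) * G B R ^ 2) ≤
      regretConst B R η δ β * √(δ + 2 * G B R ^ 2) * (q * X ^ 2) := by
    have : 0 ≤ regretConst B R η δ β := by unfold regretConst; positivity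
    have := mul_le_mul_of_nonneg_left hsqrt this
    linarith
  have hXq : X ≤ q * X ^ 2 := hXX.trans (le_mul_of_one_le_left (sq_nonneg _) hq1)
  have t2 : τ * (2 * R * G B R) ≤ 2 * R * G B R * (q * X ^ 2) := by
    rw [mul_comm]
    exact mul_le_mul_of_nonneg_left (hτX.trans hXq) (by positivity)
  have t3 : 3 * G B R * (τ * (q * (1 + η ^ 2 *
      Real.log ((δ + (K + τ) * G B R ^ 2) / δ)) / 2)) ≤
      3 * G B R * ((1 + η ^ 2 * (2 + Λ)) / 2) * (q * X ^ 2) := by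
    have h1 : 1 + η ^ 2 * Real.log ((δ + (K + τ) * G B R ^ 2) / δ) ≤
        X * (1 + η ^ 2 * (2 + Λ)) := by
      have := mul_le_mul_of_nonneg_left hlog (sq_nonneg η)
      linarith
    have h2 : τ * (q * (1 + η ^ 2 * Real.log ((δ + (K + τ) * G B R ^ 2) / δ)) / 2) ≤
        X * (q * (X * (1 + η ^ 2 * (2 + Λ))) / 2) := by
      have h3 : τ * (q * (1 + η ^ 2 * Real.log ((δ + (K + τ) * G B R ^ 2) / δ)) / 2) ≤
        τ * (q * (X * (1 + η ^ 2 * (2 + Λ))) / 2) := by gcongr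
      refine h3.trans ?_
      gcongr
    have := mul_le_mul_of_nonneg_left h2 (show 0 ≤ 3 * G B R by positivity)
    linarith
  have t4 : K * (2 * R * G B R * (κ * ρ ^ τ)) ≤ 2 * R * G B R * κ * (q * X ^ 2) := by
    have h1 := mul_le_mul_of_nonneg_left (hρτ.trans (hX1.trans hXq))
      (show 0 ≤ 2 * R * G B R * κ by positivity)
    linarith
  have main := mul_minError_le hM hs hγ₀ hγ₁ hω hR₀ hR hη hδ hβ₀ hβ₁ hθ₁ hz hK τ
  have hgω : 0 < (1 - γ) * ω := mul_pos hg hω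
  have hfin : (1 - γ) * ω * (K * minError M γ R η δ β θ₁ z μ s K hK) ≤
      (1 - γ) * ω * (rateConst B γ ω κ R η δ β * (q * X ^ 2)) := by
    have e : (1 - γ) * ω * (rateConst B γ ω κ R η δ β * (q * X ^ 2)) =
      (regretConst B R η δ β * √(δ + 2 * G B R ^ 2) + 2 * R * G B R +
        3 * G B R * ((1 + η ^ 2 * (2 + Λ)) / 2) + 2 * R * G B R * κ) * (q * X ^ 2) := by
      rw [← mul_assoc, rateConst, mul_div_cancel₀ _ hgω.ne']
    rw [e]
    refine main.trans ?_
    linarith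
  have hfin' := le_of_mul_le_mul_left hfin hgω
  rw [le_div_iff₀ (by linarith)]
  have : q * (minError M γ R η δ β θ₁ z μ s K hK * q) ≤
      q * (rateConst B γ ω κ R η δ β * X ^ 2) := by
    calc q * (minError M γ R η δ β θ₁ z μ s K hK * q)
        = q * q * minError M γ R η δ β θ₁ z μ s K hK := by ring
      _ ≤ _ := by rw [hqq]; linarith
  exact le_of_mul_le_mul_left this (by linarith)

/-! ### Orders of magnitude of C₁ and C₂. -/

theorem G_pos {B R : ℝ} (hB : 0 ≤ B) (hR : 0 < R) : 0 < G B R := by unfold G; positivity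

theorem C₂_nonneg {B γ ω κ R η δ β : ℝ} (hB : 0 ≤ B) (hγ₀ : 0 < γ) (hγ₁ : γ < 1) (hω : 0 < ω)
    (hκ : 0 < κ) (hR : 0 < R) (hη : 0 < η) (hδ : 0 < δ) (hβ₁ : β < 1) :
    0 ≤ C₂ B γ ω κ R η δ β := by
  have hG := G_pos hB hR
  have hg : 0 < 1 - γ := sub_pos.2 hγ₁
  have hβ' : 0 < 1 - β := sub_pos.2 hβ₁
  unfold C₂
  positivity

theorem le_C₁ {B γ ω ρ R η δ β : ℝ} (hB : 0 ≤ B) (hγ₁ : γ < 1) (hω : 0 < ω) (hR : 0 < R)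
    (hη : 0 < η) (hδ : 0 < δ) (hβ₀ : 0 ≤ β) (hβ₁ : β < 1) (K : ℕ) :
    16 * (Real.log K / Real.log (1 / ρ)) ^ 2 * G B R / (√δ * (1 - γ) ^ 2 * ω ^ 2) ≤
      C₁ B γ ω ρ R η δ β K := by
  have hG := G_pos hB hR
  have hg : 0 < 1 - γ := sub_pos.2 hγ₁
  have hβ' : 0 < 1 - β := sub_pos.2 hβ₁
  have h1 : 0 ≤ 2 * η * β * G B R / ((1 - β) * (1 - γ) * ω) := by positivity
  have h2 : 0 ≤ η * G B R / ((1 - γ) * ω) := by positivity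
  have h3 : 0 ≤ 4 * R * G B R ^ 2 / ((1 - γ) * ω * δ) := by positivity
  unfold C₁
  linarith

theorem tendsto_log_natCast_atTop : Tendsto (fun K : ℕ => Real.log K) atTop atTop :=
  Real.tendsto_log_atTop.comp tendsto_natCast_atTop_atTop

/-- `C₁ ln((δ + K G²) / δ)` eventually dominates any multiple of `(1 + ln K)²`. -/
theorem eventually_le_C₁_mul_log {B γ ω ρ R η δ β : ℝ} (hB : 0 ≤ B) (hγ₁ : γ < 1) (hω : 0 < ω)
    (hR : 0 < R) (hη : 0 < η) (hδ : 0 < δ) (hβ₀ : 0 ≤ β) (hβ₁ : β < 1) (hρ₀ : 0 < ρ)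
    (hρ₁ : ρ < 1) (c : ℝ) : ∀ᶠ K : ℕ in atTop, c * (1 + Real.log K) ^ 2 ≤
      C₁ B γ ω ρ R η δ β K * Real.log ((δ + K * G B R ^ 2) / δ) := by
  have hG := G_pos hB hR
  have hg : 0 < 1 - γ := sub_pos.2 hγ₁
  have hl : 0 < Real.log (1 / ρ) := Real.log_pos (one_lt_one_div hρ₀ hρ₁)
  set a := 16 * G B R / (√δ * (1 - γ) ^ 2 * ω ^ 2 * Real.log (1 / ρ) ^ 2) with ha_def
  have ha : 0 < a := by
    have := Real.sqrt_pos.2 hδ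
    positivity
  -- The leading part of C₁ is a ln² K, and the remaining logarithm supplies the unbounded factor.
  -- The threshold 4|c| comes from (1 + ln K)² ≤ 4 ln² K once ln K ≥ 1.
  have hlim : Tendsto (fun K : ℕ => a * Real.log ((δ + K * G B R ^ 2) / δ)) atTop atTop := by
    refine Tendsto.const_mul_atTop ha (Real.tendsto_log_atTop.comp
      (Tendsto.atTop_div_const hδ ?_))
    exact tendsto_atTop_add_const_left _ _
      (tendsto_natCast_atTop_atTop.atTop_mul_const (by positivity))
  filter_upwards [hlim.eventually_ge_atTop (4 * |c|),
    tendsto_log_natCast_atTop.eventually_ge_atTop 1] with K h1 h2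
  have hlog : 0 ≤ Real.log ((δ + K * G B R ^ 2) / δ) := by
    refine Real.log_nonneg ((one_le_div hδ).2 (le_add_of_nonneg_right (by positivity)))
  have h3 := mul_le_mul_of_nonneg_right
    (le_C₁ (ρ := ρ) hB hγ₁ hω hR hη hδ hβ₀ hβ₁ K) hlog
  refine le_trans ?_ h3
  have e : 16 * (Real.log K / Real.log (1 / ρ)) ^ 2 * G B R / (√δ * (1 - γ) ^ 2 * ω ^ 2) =
      a * Real.log K ^ 2 := by
    rw [ha_def, div_pow]; field_simp
  rw [e]
  calc c * (1 + Real.log K) ^ 2 ≤ |c| * (2 * Real.log K) ^ 2 := by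
        refine mul_le_mul (le_abs_self c) ?_ (sq_nonneg _) (abs_nonneg c)
        exact pow_le_pow_left₀ (by linarith) (by linarith) 2
    _ = 4 * |c| * Real.log K ^ 2 := by ring
    _ ≤ a * Real.log ((δ + K * G B R ^ 2) / δ) * Real.log K ^ 2 := by gcongr
    _ = _ := by ring

/-- Only the first term of C₁ grows with K. The others, including the one of order 1/δ, are absorbed
by the +1 because the threshold on K may depend on δ and ρ. -/
theorem exists_abs_C₁_le (B γ ω R η β : ℝ) : ∃ c : ℝ, ∀ δ : ℝ, 0 < δ → ∀ ρ : ℝ, 0 < ρ → ρ < 1 →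
    ∀ᶠ K : ℕ in atTop,
      |C₁ B γ ω ρ R η δ β K| ≤ c * ((Real.log K / Real.log (1 / ρ)) ^ 2 / √δ) := by
  refine ⟨|16 * G B R / ((1 - γ) ^ 2 * ω ^ 2)| + 1, fun δ hδ ρ hρ₀ hρ₁ => ?_⟩
  have hl : 0 < Real.log (1 / ρ) := Real.log_pos (one_lt_one_div hρ₀ hρ₁)
  have hδ' : 0 < √δ := Real.sqrt_pos.2 hδ
  have hlim : Tendsto (fun K : ℕ => (Real.log K / Real.log (1 / ρ)) ^ 2 / √δ) atTop atTop :=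
    ((tendsto_pow_atTop two_ne_zero).comp
      (tendsto_log_natCast_atTop.atTop_div_const hl)).atTop_div_const hδ'
  filter_upwards [hlim.eventually_ge_atTop |2 * η * β * G B R / ((1 - β) * (1 - γ) * ω)
    + η * G B R / ((1 - γ) * ω) + 4 * R * G B R ^ 2 / ((1 - γ) * ω * δ)|] with K hK
  set Y := (Real.log K / Real.log (1 / ρ)) ^ 2 / √δ with hY
  have hY0 : 0 ≤ Y := by positivity
  have e : C₁ B γ ω ρ R η δ β K = 16 * G B R / ((1 - γ) ^ 2 * ω ^ 2) * Y +
      (2 * η * β * G B R / ((1 - β) * (1 - γ) * ω) + η * G B R / ((1 - γ) * ω) +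
        4 * R * G B R ^ 2 / ((1 - γ) * ω * δ)) := by
    have : 16 * (Real.log K / Real.log (1 / ρ)) ^ 2 * G B R / (√δ * (1 - γ) ^ 2 * ω ^ 2) =
        16 * G B R / ((1 - γ) ^ 2 * ω ^ 2) * Y := by
      rw [hY, div_mul_div_comm]; congr 1 <;> ring
    rw [C₁, this]; ring
  rw [e]
  refine (abs_add_le _ _).trans ?_
  rw [abs_mul, abs_of_nonneg hY0]
  linarith

theorem C₂_isBigO (B γ ω κ R η β : ℝ) :
    (fun δ : ℝ => C₂ B γ ω κ R η δ β) =O[𝓝[>] 0] fun δ : ℝ => 1 / √δ := by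
  have hone : (fun _ : ℝ => (1 : ℝ)) =O[𝓝[>] 0] fun δ : ℝ => 1 / √δ := by
    refine IsBigO.of_bound 1 ?_
    filter_upwards [Ioo_mem_nhdsGT (show (0 : ℝ) < 1 by norm_num)] with δ hδ
    have h1 : 0 < √δ := Real.sqrt_pos.2 hδ.1
    have h2 : √δ ≤ 1 := Real.sqrt_le_one.2 hδ.2.le
    rw [norm_one, one_mul, Real.norm_of_nonneg (by positivity)]
    exact (one_le_div h1).2 h2
  have e : ∀ δ, C₂ B γ ω κ R η δ β = 4 * R ^ 2 * G B R / ((1 - γ) * ω * η) * 1 +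
      (4 * R * η * G B R ^ 2 / ((1 - β) * (1 - γ) * ω) +
        4 * R * κ * (B + R * γ + R) * G B R / ((1 - γ) * ω)) * (1 / √δ) := by
    intro δ
    simp only [C₂, mul_assoc, div_eq_mul_inv, mul_inv]
    ring
  simp only [e]
  exact (hone.const_mul_left _).add ((isBigO_refl _ _).const_mul_left _)

/-! ### Inverting the rate: the number of iterations. -/

theorem sq_one_add_log_le {u : ℝ} (hu : 1 ≤ u) : (1 + Real.log u) ^ 2 ≤ 16 * √u := by
  have hs : 1 ≤ √u := Real.one_le_sqrt.2 hu
  have hlu : Real.log u = 4 * Real.log √√u := by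
    rw [Real.log_sqrt (by positivity), Real.log_sqrt (by positivity)]; ring
  have h1 : Real.log √√u ≤ √√u - 1 := Real.log_le_sub_one_of_pos (by positivity)
  have h2 : 0 ≤ Real.log u := Real.log_nonneg hu
  have h3 : 1 + Real.log u ≤ 4 * √√u := by rw [hlu]; linarith
  have h4 := pow_le_pow_left₀ (by linarith) h3 2
  rw [mul_pow, Real.sq_sqrt (by positivity)] at h4
  linarith

/-- The function (1 + ln k)²/√k is not monotone on [1, ∞); the factor 16 repairs this. It follows
from 1 + ln(yu) ≤ (1 + ln y)(1 + ln u) with u = k/y. -/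
theorem sq_one_add_log_div_sqrt_le {k y : ℝ} (hy : 1 ≤ y) (hk : y ≤ k) :
    (1 + Real.log k) ^ 2 / √k ≤ 16 * (1 + Real.log y) ^ 2 / √y := by
  have hy0 : 0 < y := by linarith
  have hk0 : 0 < k := by linarith
  have hu : 1 ≤ k / y := (one_le_div hy0).2 hk
  have h1 := sq_one_add_log_le hu
  have hlu := Real.log_nonneg hu
  have hly := Real.log_nonneg hy
  have h2 : 1 + Real.log k ≤ (1 + Real.log y) * (1 + Real.log (k / y)) := by
    have : Real.log k = Real.log y + Real.log (k / y) := by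
      rw [← Real.log_mul hy0.ne' (by positivity), mul_div_cancel₀ _ hy0.ne']
    rw [this]
    nlinarith [mul_nonneg hly hlu]
  have h3 := pow_le_pow_left₀ (by linarith [Real.log_nonneg (hy.trans hk)]) h2 2
  rw [mul_pow] at h3
  have h4 := mul_le_mul_of_nonneg_left h1 (sq_nonneg (1 + Real.log y))
  rw [Real.sqrt_div hk0.le] at h4
  have hsy := Real.sqrt_pos.2 hy0
  have hsk := Real.sqrt_pos.2 hk0
  rw [div_le_iff₀ hsk]
  refine (h3.trans h4).trans (le_of_eq ?_)
  ring

/-- The complexity that makes the explicit rate smaller than the accuracy. -/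
theorem rate_le_of_complexity_le {c l₀ ρ ε K : ℝ} (hc : 0 ≤ c) (hρ₀ : 0 < ρ) (hρ₁ : ρ < 1)
    (hl : Real.log (1 / ρ) ≤ l₀) (hε₀ : 0 < ε)
    (hε : 24 * ((1 + c) * (1 + l₀)) ≤ Real.log (1 / ε))
    (hK : complexity ε ρ * Real.log (complexity ε ρ) ^ 4 ≤ K) :
    c * ((1 + 1 / Real.log (1 / ρ)) * (1 + Real.log K)) ^ 2 / √K ≤ ε := by
  have hlpos : 0 < Real.log (1 / ρ) := Real.log_pos (one_lt_one_div hρ₀ hρ₁)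
  set b := complexity ε ρ with hb
  rw [complexity] at hb
  set l := Real.log (1 / ρ)
  set T := Real.log (1 / ε) with hT
  have hexpand : 24 * ((1 + c) * (1 + l)) ≤ T := by
    refine le_trans ?_ hε
    gcongr
  have hcl : 0 ≤ c * l := mul_nonneg hc hlpos.le
  have hT1 : 1 ≤ T := by linarith
  have hTl : l ≤ T := by linarith
  have hinv : 1 / ε = Real.exp T := by rw [hT, Real.exp_log (by positivity)]
  have hb_ge : Real.exp T ≤ b := by
    have h1 : b = (T / l) ^ 4 * ((1 / ε) * (1 / ε)) := by rw [hb]; field_simp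
    have h2 : 1 ≤ (T / l) ^ 4 := one_le_pow₀ ((one_le_div hlpos).2 hTl)
    have h3 : 1 ≤ 1 / ε := by rw [hinv]; exact Real.one_le_exp (by linarith)
    rw [h1, ← hinv]
    have h4 : 1 / ε ≤ (1 / ε) * (1 / ε) := le_mul_of_one_le_left (by positivity) h3
    exact h4.trans (le_mul_of_one_le_left (by positivity) h2)
  have hb0 : 0 < b := (Real.exp_pos T).trans_le hb_ge
  set L := Real.log b with hL
  have hLT : T ≤ L := (Real.le_log_iff_exp_le hb0).2 hb_ge
  have hL1 : 1 ≤ L := hT1.trans hLT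
  have hb1 : 1 ≤ b := (Real.one_le_exp (by linarith)).trans hb_ge
  have hy : 1 ≤ b * L ^ 4 := one_le_mul_of_one_le_of_one_le hb1 (one_le_pow₀ hL1)
  have h1 := sq_one_add_log_div_sqrt_le hy hK
  -- The constant 6 has slack; it makes the final factor 16 · 6² = 24², which matches the 24 in the
  -- threshold on ε.
  have hlogy : 1 + Real.log (b * L ^ 4) ≤ 6 * L := by
    rw [Real.log_mul hb0.ne' (by positivity), Real.log_pow]
    have := Real.log_le_sub_one_of_pos (show 0 < L by linarith)
    push_cast
    linarith
  have hsq : √(b * L ^ 4) = T ^ 2 * L ^ 2 / (ε * l ^ 2) := by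
    have : b * L ^ 4 = (T ^ 2 * L ^ 2 / (ε * l ^ 2)) ^ 2 := by
      nth_rewrite 1 [hb]; field_simp
    rw [this, Real.sqrt_sq (by positivity)]
  have h2 : (1 + Real.log (b * L ^ 4)) ^ 2 ≤ (6 * L) ^ 2 :=
    pow_le_pow_left₀ (by linarith [Real.log_nonneg hy]) hlogy 2
  have h3 : 16 * (1 + Real.log (b * L ^ 4)) ^ 2 / √(b * L ^ 4) ≤ 576 * (ε * l ^ 2) / T ^ 2 := by
    calc 16 * (1 + Real.log (b * L ^ 4)) ^ 2 / √(b * L ^ 4)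
        ≤ 16 * (6 * L) ^ 2 / √(b * L ^ 4) := by gcongr
      _ = _ := by rw [hsq]; field_simp; ring
  -- The factor l² from the complexity turns (1 + 1/l)² into (1 + l)², which is bounded for ρ ≥ ρ₀;
  -- largeness of T = ln(1/ε) absorbs the rest.
  have h4 : c * (1 + 1 / l) ^ 2 * (576 * (ε * l ^ 2) / T ^ 2) ≤ ε := by
    have h5 : 576 * c * (1 + l) ^ 2 ≤ T ^ 2 := by
      have h6 := pow_le_pow_left₀ (by positivity) hexpand 2
      refine le_trans ?_ h6
      have h7 : c ≤ (1 + c) ^ 2 := by nlinarith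
      calc 576 * c * (1 + l) ^ 2 ≤ 576 * (1 + c) ^ 2 * (1 + l) ^ 2 := by gcongr
        _ = _ := by ring
    have e : c * (1 + 1 / l) ^ 2 * (576 * (ε * l ^ 2) / T ^ 2) =
        ε * (576 * c * (1 + l) ^ 2) / T ^ 2 := by field_simp; ring
    rw [e, div_le_iff₀ (by positivity)]
    exact mul_le_mul_of_nonneg_left h5 hε₀.le
  calc c * ((1 + 1 / l) * (1 + Real.log K)) ^ 2 / √K
      = c * (1 + 1 / l) ^ 2 * ((1 + Real.log K) ^ 2 / √K) := by ring
    _ ≤ c * (1 + 1 / l) ^ 2 * (576 * (ε * l ^ 2) / T ^ 2) := by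
        exact mul_le_mul_of_nonneg_left (h1.trans h3) (by positivity)
    _ ≤ ε := h4

end AdaTD

end

/-! ### Assembly of the theorem. -/

theorem theorem1 (B γ ω κ R η δ β : ℝ) (hγ₀ : 0 < γ) (hγ₁ : γ < 1) (hω : 0 < ω) (hκ : 0 < κ)
    (hR₀ : 0 < R) (hR : 2 * B / (√ω * (1 - γ) ^ (3 / 2 : ℝ)) ≤ R)
    (hη : 0 < η) (hδ : 0 < δ) (hβ₀ : 0 ≤ β) (hβ₁ : β < 1) :
    -- the finite-time bound
    (∀ ρ : ℝ, 0 < ρ → ρ < 1 → ∃ K₁ : ℕ,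
      ∀ (S : Type u) [Fintype S] [DecidableEq S] [MeasurableSpace S] [MeasurableSingletonClass S]
        (d : ℕ) (M : AdaTD.Model S d), M.Assumptions B κ ρ ω →
      ∀ θstar : EuclideanSpace ℝ (Fin d), M.IsProjectedBellmanSolution γ θstar →
      ∀ (Ω : Type v) [MeasurableSpace Ω] (μ : Measure Ω) [IsProbabilityMeasure μ]
        (s : ℕ → Ω → S), AdaTD.IsMarkovChain M.P μ s →
      ∀ θ₁ : EuclideanSpace ℝ (Fin d), ‖θ₁‖ ≤ R →
      ∀ (K : ℕ) (hK : 1 ≤ K), K₁ ≤ K →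
        AdaTD.minError M γ R η δ β θ₁ θstar μ s K hK ≤
          AdaTD.C₁ B γ ω ρ R η δ β K * Real.log ((δ + K * AdaTD.G B R ^ 2) / δ) / √K
            + AdaTD.C₂ B γ ω κ R η δ β / √K) ∧
    -- the order of `C₁`: the implied constant does not depend on `δ`, `ρ`, `K`
    (∃ c : ℝ, ∀ δ' : ℝ, 0 < δ' → ∀ ρ : ℝ, 0 < ρ → ρ < 1 → ∀ᶠ K : ℕ in atTop,
      |AdaTD.C₁ B γ ω ρ R η δ' β K| ≤ c * ((Real.log K / Real.log (1 / ρ)) ^ 2 / √δ')) ∧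
    -- the order of `C₂`
    ((fun δ' : ℝ => AdaTD.C₂ B γ ω κ R η δ' β) =O[𝓝[>] 0] fun δ' : ℝ => 1 / √δ') ∧
    -- the number of iterations that suffices for accuracy `ε`
    (∃ (C : ℝ) (p : ℕ), 0 < C ∧ ∀ ρ₀ : ℝ, 0 < ρ₀ → ρ₀ < 1 → ∃ ε₀ : ℝ, 0 < ε₀ ∧ ε₀ < 1 ∧
      ∀ ρ : ℝ, ρ₀ ≤ ρ → ρ < 1 → ∀ ε : ℝ, 0 < ε → ε < ε₀ →
      ∀ (S : Type u) [Fintype S] [DecidableEq S] [MeasurableSpace S] [MeasurableSingletonClass S]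
        (d : ℕ) (M : AdaTD.Model S d), M.Assumptions B κ ρ ω →
      ∀ θstar : EuclideanSpace ℝ (Fin d), M.IsProjectedBellmanSolution γ θstar →
      ∀ (Ω : Type v) [MeasurableSpace Ω] (μ : Measure Ω) [IsProbabilityMeasure μ]
        (s : ℕ → Ω → S), AdaTD.IsMarkovChain M.P μ s →
      ∀ θ₁ : EuclideanSpace ℝ (Fin d), ‖θ₁‖ ≤ R →
      ∀ (K : ℕ) (hK : 1 ≤ K),
        C * AdaTD.complexity ε ρ * Real.log (AdaTD.complexity ε ρ) ^ p ≤ K →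
        AdaTD.minError M γ R η δ β θ₁ θstar μ s K hK ≤ ε) := by
  -- C = 1 and p = 4 suffice, since the rate coefficient is absorbed in the choice of ε₀.
  refine ⟨fun ρ hρ₀ hρ₁ => ?_, AdaTD.exists_abs_C₁_le B γ ω R η β,
    AdaTD.C₂_isBigO B γ ω κ R η β, 1, 4, one_pos, fun ρ₀ hρ₀ hρ₀₁ => ?_⟩
  · by_cases hB : 0 ≤ B
    · obtain ⟨K₁, hK₁⟩ := eventually_atTop.1 (AdaTD.eventually_le_C₁_mul_log hB hγ₁ hω hR₀ hη hδ
        hβ₀ hβ₁ hρ₀ hρ₁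
        (AdaTD.rateConst B γ ω κ R η δ β * (1 + 1 / Real.log (1 / ρ)) ^ 2))
      refine ⟨K₁, ?_⟩
      intro S _ _ _ _ d M hM θstar hstar Ω _ μ _ s hs θ₁ hθ₁ K hK hKK
      refine (AdaTD.minError_le hM hs hγ₀ hγ₁ hω hκ hR₀ hR hη hδ hβ₀ hβ₁ hρ₀ hρ₁ hθ₁ hstar
        hK).trans ?_
      have h1 := hK₁ K hKK
      have h2 : 0 ≤ AdaTD.C₂ B γ ω κ R η δ β / √K :=
        div_nonneg (AdaTD.C₂_nonneg hB hγ₀ hγ₁ hω hκ hR₀ hη hδ hβ₁) (Real.sqrt_nonneg _)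
      refine le_add_of_le_of_nonneg ?_ h2
      rw [mul_pow, ← mul_assoc]
      exact div_le_div_of_nonneg_right h1 (Real.sqrt_nonneg _)
    -- For B < 0 no model qualifies: the chain makes the state space nonempty, which forces B ≥ 0.
    · refine ⟨0, ?_⟩
      intro S _ _ _ _ d M hM θstar hstar Ω _ μ _ s hs
      have := hs.nonempty
      exact absurd hM.reward_bound_nonneg hB
  · have hl₀ : 0 < Real.log (1 / ρ₀) := Real.log_pos (one_lt_one_div hρ₀ hρ₀₁)
    -- The absolute value is needed because ε₀ is chosen before any model is given, and B ≥ 0 is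
    -- known only from a model.
    have hc : 0 ≤ |AdaTD.rateConst B γ ω κ R η δ β| := abs_nonneg _
    set T := 24 * ((1 + |AdaTD.rateConst B γ ω κ R η δ β|) * (1 + Real.log (1 / ρ₀)))
    have hT : 0 < T := by positivity
    refine ⟨Real.exp (-T), Real.exp_pos _, Real.exp_lt_one_iff.2 (by linarith), ?_⟩
    intro ρ hρ hρ₁ ε hε₀ hε S _ _ _ _ d M hM θstar hstar Ω _ μ _ s hs θ₁ hθ₁ K hK hKK
    have := hs.nonempty
    have hcB := AdaTD.rateConst_nonneg (β := β) hM.reward_bound_nonneg hγ₁ hω hκ hR₀ hη hδ hβ₁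
    have hρpos : 0 < ρ := hρ₀.trans_le hρ
    refine (AdaTD.minError_le hM hs hγ₀ hγ₁ hω hκ hR₀ hR hη hδ hβ₀ hβ₁ hρpos hρ₁ hθ₁ hstar
      hK).trans ?_
    refine AdaTD.rate_le_of_complexity_le (l₀ := Real.log (1 / ρ₀)) hcB hρpos hρ₁ ?_ hε₀ ?_
      (by rwa [one_mul] at hKK)
    · exact Real.log_le_log (by positivity) (one_div_le_one_div_of_le hρ₀ hρ)
    · rw [← abs_of_nonneg hcB, one_div ε, Real.log_inv]
      have := (Real.log_lt_log hε₀ hε).le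
      rw [Real.log_exp] at this
      linarith
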